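/- Let $K_0,\tau_1,\tau_2>0$. For $\omega\in\mathbb R$ (the frequency deviation $\omega_\Delta^{\rm free}$) consider the phase-locked loop with active PI filter and sinusoidal phase detector, $$\dot x=\sin\theta,\qquad \dot\theta=\omega-\frac{K_0}{\tau_1}\bigl(x+\tau_2\sin\theta\bigr),\qquad (\theta,x)\in\mathbb R^2 ,$$ and put $x_{eq}(\omega)=\omega\tau_1/K_0$. Locked states are the locally asymptotically stable equilibria. A solution slips cycles if $\limsup_{t\to+\infty}|\theta(0)-\theta(t)|\ge 2\pi$. The lock-in domain $D(\omega)$ is the set of states from which the solution tends to a locked state without slipping cycles. The lock-in frequency $\omega_l$ is the largest $W\ge 0$ such that for every $|\omega|<W$ each solution tends to an equilibrium and every locked state for $\omega$ lies in $\bigcap_{|\omega'|<W}D(\omega')$. The pull-out frequency $\omega_{po}(\omega)$ is the largest $s\ge0$ such that no cycle slips when the loop is in a locked state for the deviation $\omega$ and the deviation jumps at $t=0$ to $\omega+\Delta$ with $|\Delta|=s$. The lower separatrix for $\omega$ is the set of points whose solution satisfies $x(t)<x_{eq}(\omega)$ for all $t\ge0$ and tends to the saddle $(\theta,x)=(\pi,x_{eq}(\omega))$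 as $t\to+\infty$. Then: 1. For all $\omega\in\mathbb R$ and $\theta\in[0,\pi)$ there is exactly one $x=:Q(\theta,\omega)$ with $(\theta,x)$ on the lower separatrix for $\omega$. 2. The maximum $\omega_l$ exists, and for every $\omega\in\mathbb R$ the maximum $\omega_{po}(\omega)$ exists. 3. For every $\omega$: if $|\Delta|<\omega_{po}(\omega)$, then every locked state for $\omega$ lies in $D(\omega+\Delta)$; if $|\Delta|>\omega_{po}(\omega)$, then the solution for the deviation $\omega+\Delta$ that starts at any locked state for $\omega$ slips cycles. 4. For every $\omega$, $x_{eq}(\omega)=Q(0,\omega+\omega_{po}(\omega))$ and $$\omega_{po}(\omega)=-\frac{K_0\,Q(0,0)}{\tau_1}=2\omega_l .$$ In particular, the pull-out frequency does not depend on $\omega$. -/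

import Mathlib

open Filter Topology Set

noncomputable section

namespace PLL

/-- Right-hand side of the phase-space model of the PLL with active PI filter and sinusoidal
phase detector.  Points of the phase plane are written `(θ, x)`: phase error `θ`, filter state `x`;
`K₀` is the loop gain, `τ₁, τ₂` are the filter parameters and `ω` is the frequency deviation. -/
def field (K₀ τ₁ τ₂ ω : ℝ) (p : ℝ × ℝ) : ℝ × ℝ :=
  (ω - K₀ / τ₁ * (p.2 + τ₂ * Real.sin p.1), Real.sin p.1)

/-- `z = (θ, x)` solves `θ' = ω - (K₀/τ₁)(x + τ₂ sin θ)`, `x' = sin θ` on the whole time axis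
(the right-hand side is globally Lipschitz, so every solution extends to the whole axis). -/
def IsTrajectory (K₀ τ₁ τ₂ ω : ℝ) (z : ℝ → ℝ × ℝ) : Prop :=
  ∀ t : ℝ, HasDerivAt z (field K₀ τ₁ τ₂ ω (z t)) t

def IsEquilibrium (K₀ τ₁ τ₂ ω : ℝ) (p : ℝ × ℝ) : Prop :=
  field K₀ τ₁ τ₂ ω p = 0

/-- The filter state at the equilibria. -/
def xeq (K₀ τ₁ ω : ℝ) : ℝ := ω * τ₁ / K₀

/-- Lyapunov stability together with local attraction. -/
def IsLocallyAsymptoticallyStable (K₀ τ₁ τ₂ ω : ℝ) (p : ℝ × ℝ) : Prop :=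
  (∀ ε > 0, ∃ δ > 0, ∀ z, IsTrajectory K₀ τ₁ τ₂ ω z → dist (z 0) p < δ →
    ∀ t, 0 ≤ t → dist (z t) p < ε) ∧
  ∃ δ > 0, ∀ z, IsTrajectory K₀ τ₁ τ₂ ω z → dist (z 0) p < δ → Tendsto z atTop (𝓝 p)

/-- Locked states: the locally asymptotically stable equilibria. -/
def IsLockedState (K₀ τ₁ τ₂ ω : ℝ) (p : ℝ × ℝ) : Prop :=
  IsEquilibrium K₀ τ₁ τ₂ ω p ∧ IsLocallyAsymptoticallyStable K₀ τ₁ τ₂ ω p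

/-- Global asymptotic stability: every solution tends to an equilibrium. -/
def IsGloballyAsymptoticallyStable (K₀ τ₁ τ₂ ω : ℝ) : Prop :=
  ∀ z, IsTrajectory K₀ τ₁ τ₂ ω z → ∃ p, IsEquilibrium K₀ τ₁ τ₂ ω p ∧ Tendsto z atTop (𝓝 p)

/-- Cycle slipping: `limsup_{t → +∞} |θ(0) - θ(t)| ≥ 2π`.  The limsup is taken in the extended
reals, so that an unbounded phase error counts as slipping. -/
def CycleSlips (z : ℝ → ℝ × ℝ) : Prop :=
  ((2 * Real.pi : ℝ) : EReal) ≤ limsup (fun t : ℝ => ((|(z 0).1 - (z t).1| : ℝ) : EReal)) atTop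

/-- The lock-in domain: the states from which the loop synchronizes (tends to a locked state)
without cycle slipping. -/
def lockInDomain (K₀ τ₁ τ₂ ω : ℝ) : Set (ℝ × ℝ) :=
  {p | ∃ z, IsTrajectory K₀ τ₁ τ₂ ω z ∧ z 0 = p ∧
    (∃ q, IsLockedState K₀ τ₁ τ₂ ω q ∧ Tendsto z atTop (𝓝 q)) ∧ ¬ CycleSlips z}

/-- `[0, W)` has the lock-in property: for all deviations smaller than `W` the model is globally
asymptotically stable, and the intersection of the lock-in domains over all these deviations
contains all the corresponding locked states. -/
def IsLockInRange (K₀ τ₁ τ₂ W : ℝ) : Prop :=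
  ∀ ω : ℝ, |ω| < W → IsGloballyAsymptoticallyStable K₀ τ₁ τ₂ ω ∧
    ∀ p, IsLockedState K₀ τ₁ τ₂ ω p → p ∈ ⋂ ω' ∈ {ω' : ℝ | |ω'| < W}, lockInDomain K₀ τ₁ τ₂ ω'

def lockInBounds (K₀ τ₁ τ₂ : ℝ) : Set ℝ := {W | 0 ≤ W ∧ IsLockInRange K₀ τ₁ τ₂ W}

/-- The lock-in frequency `ω_l`. -/
def lockInFrequency (K₀ τ₁ τ₂ : ℝ) : ℝ := sSup (lockInBounds K₀ τ₁ τ₂)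

/-- The sizes `s` of frequency steps without cycle slip: whenever the loop is in a locked state for
the deviation `ω` and the deviation jumps at `t = 0` to `ω + Δ`, `|Δ| = s`, no cycle slips. -/
def slipFreeSteps (K₀ τ₁ τ₂ ω : ℝ) : Set ℝ :=
  {s | 0 ≤ s ∧ ∀ Δ : ℝ, |Δ| = s → ∀ p, IsLockedState K₀ τ₁ τ₂ ω p →
    ∀ z, IsTrajectory K₀ τ₁ τ₂ (ω + Δ) z → z 0 = p → ¬ CycleSlips z}

/-- The pull-out frequency `ω_po` of the loop operating at the deviation `ω`. -/
def pullOutFrequency (K₀ τ₁ τ₂ ω : ℝ) : ℝ := sSup (slipFreeSteps K₀ τ₁ τ₂ ω)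

/-- The lower separatrix of the saddle `(π, xeq ω)`: the points whose forward trajectory tends to
the saddle through the half plane `x < xeq ω`. -/
def lowerSeparatrix (K₀ τ₁ τ₂ ω : ℝ) : Set (ℝ × ℝ) :=
  {p | ∃ z, IsTrajectory K₀ τ₁ τ₂ ω z ∧ z 0 = p ∧ (∀ t, 0 ≤ t → (z t).2 < xeq K₀ τ₁ ω) ∧
    Tendsto z atTop (𝓝 (Real.pi, xeq K₀ τ₁ ω))}

/-- `Q(θ, ω)`: the filter state on the lower separatrix at the phase error `θ`. -/
def Q (K₀ τ₁ τ₂ θ ω : ℝ) : ℝ :=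
  Classical.epsilon fun x : ℝ => (θ, x) ∈ lowerSeparatrix K₀ τ₁ τ₂ ω

end PLL

end

/-! With `v = ω - (K₀/τ₁) x`, `a = K₀/τ₁`, `b = a τ₂`, the loop becomes `θ' = v - b sin θ`, `v' = -a
sin θ`, and `ω` is gone. A jump of the deviation by `Δ` leaves `θ` and `x` unchanged, so a locked
state becomes the point `(2kπ, Δ)` of one fixed phase portrait. This is why the pull-out frequency
cannot depend on `ω`.

The energy `v²/2 + a(1 - cos θ)` has derivative `-ab sin² θ`. With Barbalat's lemma every trajectory
tends to some `(kπ, 0)`; below the saddle level `2a` it is trapped in its well (`IsPend.trapped`).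
While `v > 0`, the lines `θ = kπ` are crossed only upwards, so passing `π` with `v > 0` means a
limit `mπ` with `m ≥ 2` (`IsPend.two_le_of_tendsto`).

Over a phase in `[0, π)`, the heights `v > 0` leading to the own well and those leading to `m ≥ 2`
form disjoint nonempty open sets. By connectedness some height `V` leads to the saddle `(π, 0)`;
comparing two such trajectories at equal phase shows that it is unique (`IsSep.snd_eq`). Hence
`exists_critical_height`.

Let `V` be the critical height over `θ = 0`. By symmetry a step with `|Δ| < V` relocks in the same
well, `|Δ| = V` ends at a saddle at distance `π < 2π` (no slip, no lock), and `|Δ| > V` slips. So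
the pull-out frequency is `V`. Deviations in `(-W, W)` differ by less than `2W`, which gives the
lock-in frequency `V/2`. In the original coordinates the separatrix point is `x = (ω - V)/a`. -/

namespace PLL

/-! ### Global integral curves and Barbalat's lemma -/

/-- A `C¹` and globally Lipschitz vector field on a Banach space has global integral curves. -/
theorem exists_trajectory_of_lipschitzWith {E : Type*} [NormedAddCommGroup E] [NormedSpace ℝ E]
    [CompleteSpace E] {f : E → E} {K : NNReal} (hf : ContDiff ℝ 1 f) (hK : LipschitzWith K f)
    (x : E) : ∃ γ : ℝ → E, γ 0 = x ∧ ∀ t, HasDerivAt γ (f (γ t)) t := by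
  -- On the ball of radius `‖f x‖ + 1` around `x` the field is bounded by `(K + 1)(‖f x‖ + 1)`, so
  -- the Picard–Lindelöf time can be chosen independently of `x`; uniformity is what allows the
  -- local curves to be continued globally.
  have hε : (0 : ℝ) < 1 / (2 * (K + 1)) := by positivity
  have hloc : ∀ x : E, ∃ γ : ℝ → E, γ 0 = x ∧
      IsMIntegralCurveOn (I := modelWithCornersSelf ℝ E) γ f
        (Ioo (-(1 / (2 * (K + 1)) : ℝ)) (1 / (2 * (K + 1)))) := by
    intro x
    set ε : ℝ := 1 / (2 * (K + 1)) with hεdef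
    have hpl : IsPicardLindelof (fun _ : ℝ => f) (tmin := -ε) (tmax := ε)
        ⟨0, by constructor <;> linarith⟩ x (‖f x‖₊ + 1) 0 (K * (‖f x‖₊ + 1) + ‖f x‖₊) K := by
      apply IsPicardLindelof.of_time_independent
      · intro y hy
        have h1 := hK.dist_le_mul y x
        rw [dist_eq_norm] at h1
        have h2 : dist y x ≤ ‖f x‖ + 1 := by simpa using hy
        have h3 : ‖f y‖ ≤ ‖f y - f x‖ + ‖f x‖ := by
          simpa using norm_add_le (f y - f x) (f x)
        have h4 : (K : ℝ) * dist y x ≤ K * (‖f x‖ + 1) := by gcongr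
        push_cast
        linarith
      · exact hK.lipschitzOnWith
      · push_cast
        simp only [sub_zero, zero_sub, neg_neg, max_self]
        have : (K : ℝ) * (‖f x‖ + 1) + ‖f x‖ ≤ (K + 1) * (‖f x‖ + 1) := by nlinarith
        calc _ ≤ ((K : ℝ) + 1) * (‖f x‖ + 1) * ε := by gcongr
          _ = (‖f x‖ + 1) / 2 := by rw [hεdef]; field_simp
          _ ≤ _ := by linarith [norm_nonneg (f x)]
    obtain ⟨γ, hγ0, hγ⟩ := hpl.exists_eq_forall_mem_Icc_hasDerivWithinAt₀
    refine ⟨γ, hγ0, fun t ht => ?_⟩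
    exact ((hγ t (Ioo_subset_Icc_self ht)).hasDerivAt
      (Icc_mem_nhds ht.1 ht.2)).hasFDerivAt.hasMFDerivAt.hasMFDerivWithinAt
  obtain ⟨γ, hγ0, hγ⟩ := exists_isMIntegralCurve_of_isMIntegralCurveOn
    (I := modelWithCornersSelf ℝ E) (v := f)
    (contMDiff_vectorSpace_iff_contDiff.2 hf) hε hloc x
  refine ⟨γ, hγ0, fun t => ?_⟩
  have h : HasFDerivAt γ ((1 : ℝ →L[ℝ] ℝ).smulRight (f (γ t))) t :=
    hasMFDerivAt_iff_hasFDerivAt.1 (hγ t)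
  exact h.hasDerivAt.congr_deriv (by simp)

/-- Barbalat's lemma: if `f` converges and `f''` is bounded, then `f'` tends to zero. -/
theorem tendsto_deriv_zero_of_tendsto {f g h : ℝ → ℝ} {l C : ℝ}
    (hf : ∀ t, HasDerivAt f (g t) t) (hg : ∀ t, HasDerivAt g (h t) t)
    (hh : ∀ t, 0 ≤ t → |h t| ≤ C) (hl : Tendsto f atTop (𝓝 l)) : Tendsto g atTop (𝓝 0) := by
  rw [Metric.tendsto_atTop]
  intro ε hε
  have hC : 0 ≤ C := (abs_nonneg _).trans (hh 0 le_rfl)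
  -- Over a time `δ` the function `g` varies by at most `ε / 2`; the mean value theorem supplies a
  -- point in each such window where `g` equals a small difference quotient of `f`.
  set δ : ℝ := ε / (2 * (C + 1)) with hδdef
  have hδ : 0 < δ := by positivity
  have hlim : Tendsto (fun t => (f (t + δ) - f t) / δ) atTop (𝓝 0) := by
    have := ((hl.comp (tendsto_atTop_add_const_right atTop δ tendsto_id)).sub hl).div_const δ
    simpa using this
  obtain ⟨N, hN⟩ := Metric.tendsto_atTop.1 hlim (ε / 2) (by positivity)
  refine ⟨max N 0, fun t ht => ?_⟩
  have htN : N ≤ t := (le_max_left _ _).trans ht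
  have ht0 : 0 ≤ t := (le_max_right _ _).trans ht
  obtain ⟨c, hc, hc'⟩ := exists_hasDerivAt_eq_slope f g (show t < t + δ by linarith)
    (fun s _ => (hf s).continuousAt.continuousWithinAt) (fun s _ => hf s)
  have h1 := hN t htN
  rw [Real.dist_eq, sub_zero] at h1 ⊢
  have h2 : |g c| < ε / 2 := by
    rw [hc']; simpa using h1
  have h3 : ‖g c - g t‖ ≤ C * (c - t) :=
    norm_image_sub_le_of_norm_deriv_le_segment' (f := g) (f' := h) (a := t) (b := c)
      (fun s _ => (hg s).hasDerivWithinAt) (fun s hs => hh s (ht0.trans hs.1)) c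
      ⟨hc.1.le, le_rfl⟩
  have h4 : C * (c - t) ≤ (C + 1) * δ := by
    have : c - t ≤ δ := by linarith [hc.2]
    nlinarith [hc.1]
  have h5 : (C + 1) * δ = ε / 2 := by rw [hδdef]; field_simp
  rw [Real.norm_eq_abs] at h3
  have h6 : |g t| ≤ |g c - g t| + |g c| := by
    have := abs_sub_abs_le_abs_sub (g t) (g c)
    rw [abs_sub_comm] at this
    linarith
  linarith

/-! ### The pendulum form of the loop and its symmetries -/

/-- The loop in the coordinates `(θ, v)`, `v = ω - (K₀/τ₁) x`, with `a = K₀/τ₁`, `b = a τ₂`: a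
pendulum with position-dependent damping. -/
noncomputable def pendField (a b : ℝ) (p : ℝ × ℝ) : ℝ × ℝ := (p.2 - b * Real.sin p.1, -(a * Real.sin p.1))

def IsPend (a b : ℝ) (u : ℝ → ℝ × ℝ) : Prop := ∀ t, HasDerivAt u (pendField a b (u t)) t

theorem contDiff_pendField (a b : ℝ) : ContDiff ℝ 1 (pendField a b) := by
  unfold pendField
  have := Real.contDiff_sin (n := 1)
  fun_prop

theorem abs_sin_sub_sin_le (x y : ℝ) : |Real.sin x - Real.sin y| ≤ |x - y| := by
  have := Real.lipschitzWith_sin.dist_le_mul x y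
  simpa [Real.dist_eq] using this

theorem lipschitzWith_pendField {a b : ℝ} (ha : 0 < a) (hb : 0 < b) :
    LipschitzWith (Real.toNNReal (1 + a + b)) (pendField a b) := by
  apply LipschitzWith.of_dist_le_mul
  intro p q
  rw [Real.coe_toNNReal _ (by positivity), Prod.dist_eq]
  have h1 : |p.1 - q.1| ≤ dist p q := by rw [← Real.dist_eq]; exact le_max_left _ _
  have h2 : |p.2 - q.2| ≤ dist p q := by rw [← Real.dist_eq]; exact le_max_right _ _
  have h3 := (abs_sin_sub_sin_le p.1 q.1).trans h1
  have h0 : 0 ≤ dist p q := dist_nonneg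
  apply max_le
  · rw [Real.dist_eq]
    calc |p.2 - b * Real.sin p.1 - (q.2 - b * Real.sin q.1)|
        = |(p.2 - q.2) - b * (Real.sin p.1 - Real.sin q.1)| := by ring_nf
      _ ≤ |p.2 - q.2| + |b * (Real.sin p.1 - Real.sin q.1)| := abs_sub _ _
      _ ≤ dist p q + b * dist p q := by
        rw [abs_mul, abs_of_pos hb]; gcongr
      _ ≤ _ := by nlinarith
  · rw [Real.dist_eq]
    calc |-(a * Real.sin p.1) - -(a * Real.sin q.1)|
        = |a * (Real.sin p.1 - Real.sin q.1)| := by rw [← abs_neg]; ring_nf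
      _ ≤ a * dist p q := by rw [abs_mul, abs_of_pos ha]; gcongr
      _ ≤ _ := by nlinarith

section

variable {a b : ℝ} {u w : ℝ → ℝ × ℝ}

theorem exists_isPend (ha : 0 < a) (hb : 0 < b) (p : ℝ × ℝ) : ∃ u, u 0 = p ∧ IsPend a b u :=
  exists_trajectory_of_lipschitzWith (contDiff_pendField a b) (lipschitzWith_pendField ha hb) p

theorem IsPend.continuous (hu : IsPend a b u) : Continuous u :=
  continuous_iff_continuousAt.2 fun t => (hu t).continuousAt

theorem IsPend.hasDerivAt_fst (hu : IsPend a b u) (t : ℝ) :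
    HasDerivAt (fun t => (u t).1) ((u t).2 - b * Real.sin (u t).1) t :=
  (ContinuousLinearMap.fst ℝ ℝ ℝ).hasFDerivAt.comp_hasDerivAt t (hu t)

theorem IsPend.hasDerivAt_snd (hu : IsPend a b u) (t : ℝ) :
    HasDerivAt (fun t => (u t).2) (-(a * Real.sin (u t).1)) t :=
  (ContinuousLinearMap.snd ℝ ℝ ℝ).hasFDerivAt.comp_hasDerivAt t (hu t)

theorem IsPend.eq_of_eq (ha : 0 < a) (hb : 0 < b) (hu : IsPend a b u) (hw : IsPend a b w)
    {t₀ : ℝ} (h : u t₀ = w t₀) : u = w :=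
  ODE_solution_unique_univ (v := fun _ => pendField a b) (s := fun _ => univ)
    (fun _ => (lipschitzWith_pendField ha hb).lipschitzOnWith)
    (fun t => ⟨hu t, trivial⟩) (fun t => ⟨hw t, trivial⟩) h

theorem IsPend.dist_le (ha : 0 < a) (hb : 0 < b) (hu : IsPend a b u) (hw : IsPend a b w)
    {t : ℝ} (ht : 0 ≤ t) : dist (u t) (w t) ≤ dist (u 0) (w 0) * Real.exp ((1 + a + b) * t) := by
  have := dist_le_of_trajectories_ODE (v := fun _ => pendField a b) (a := 0) (b := t)
    (fun _ => lipschitzWith_pendField ha hb) hu.continuous.continuousOn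
    (fun s _ => (hu s).hasDerivWithinAt) hw.continuous.continuousOn
    (fun s _ => (hw s).hasDerivWithinAt) le_rfl t ⟨ht, le_rfl⟩
  rwa [Real.coe_toNNReal _ (by positivity), sub_zero] at this

theorem IsPend.comp_add (hu : IsPend a b u) (s : ℝ) : IsPend a b (fun t => u (t + s)) :=
  fun t => HasDerivAt.comp_add_const t s (hu (t + s))

theorem IsPend.neg (hu : IsPend a b u) : IsPend a b (fun t => -u t) := by
  intro t
  refine (hu t).neg.congr_deriv ?_
  ext
  · simp [pendField]
    ring
  · simp [pendField]

theorem IsPend.add_two_pi (hu : IsPend a b u) (k : ℤ) :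
    IsPend a b (fun t => u t + ((k : ℝ) * (2 * Real.pi), 0)) := by
  intro t
  refine ((hu t).add_const _).congr_deriv ?_
  ext <;> simp [pendField]

end

/-! ### Two facts about continuous real functions -/

/-- A continuous function whose sine tends to zero converges to a multiple of `π`. -/
theorem exists_tendsto_int_mul_pi {f : ℝ → ℝ} (hf : Continuous f)
    (h : Tendsto (fun t => Real.sin (f t)) atTop (𝓝 0)) :
    ∃ k : ℤ, Tendsto f atTop (𝓝 (k * Real.pi)) := by
  have hπ := Real.pi_pos
  obtain ⟨N, hN⟩ := Metric.tendsto_atTop.1 h 1 one_pos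
  simp only [Real.dist_eq, sub_zero] at hN
  set k := round (f N / Real.pi) with hk
  have hsin : ∀ t, |Real.sin (f t - k * Real.pi)| = |Real.sin (f t)| := by
    intro t
    rw [Real.sin_sub_int_mul_pi, abs_mul, abs_neg_one_zpow, one_mul]
  -- At distance `π / 2` from `kπ` the sine has modulus `1`, so once `|sin| < 1` these points are
  -- barriers.
  have hne : ∀ t, N ≤ t → |f t - k * Real.pi| ≠ Real.pi / 2 := by
    intro t ht hc
    have h1 := hN t ht
    rw [← hsin] at h1
    rcases (abs_eq (by positivity)).1 hc with h2 | h2 <;> rw [h2] at h1 <;> simp at h1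
  have h0 : |f N - k * Real.pi| < Real.pi / 2 := by
    refine lt_of_le_of_ne ?_ (hne N le_rfl)
    have h1 := abs_sub_round (f N / Real.pi)
    have h2 : f N - k * Real.pi = (f N / Real.pi - k) * Real.pi := by field_simp
    rw [h2, abs_mul, abs_of_pos hπ]
    nlinarith
  have hlt : ∀ t, N ≤ t → |f t - k * Real.pi| < Real.pi / 2 := by
    intro t ht
    by_contra! hc
    have hcont : ContinuousOn (fun t => |f t - k * Real.pi|) (Icc N t) := by fun_prop
    obtain ⟨s, hs, hs'⟩ := intermediate_value_Icc ht hcont ⟨h0.le, hc⟩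
    exact hne s hs.1 hs'
  have h1 : Tendsto (fun t => Real.sin (f t - k * Real.pi)) atTop (𝓝 0) := by
    rw [tendsto_zero_iff_abs_tendsto_zero] at h ⊢
    simpa [Function.comp_def, hsin] using h
  have h2 : Tendsto (fun t => Real.arcsin (Real.sin (f t - k * Real.pi))) atTop (𝓝 0) := by
    simpa [Function.comp_def] using (Real.continuous_arcsin.tendsto 0).comp h1
  refine ⟨k, ?_⟩
  have h3 : Tendsto (fun t => f t - k * Real.pi) atTop (𝓝 0) := by
    refine h2.congr' ?_
    filter_upwards [eventually_ge_atTop N] with t ht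
    have := abs_lt.1 (hlt t ht)
    exact Real.arcsin_sin (by linarith) (by linarith)
  simpa using h3.add_const (k * Real.pi)

/-- A continuous function that starts positive stays positive or has a first zero. -/
theorem forall_pos_or_exists_first_zero {f : ℝ → ℝ} (hf : Continuous f) (h0 : 0 < f 0) :
    (∀ t, 0 ≤ t → 0 < f t) ∨ ∃ t₁, 0 < t₁ ∧ f t₁ = 0 ∧ ∀ t, 0 ≤ t → t < t₁ → 0 < f t := by
  rw [or_iff_not_imp_left]
  intro h
  push Not at h
  obtain ⟨s, hs0, hs⟩ := h
  set S := {t | 0 ≤ t ∧ f t ≤ 0} with hS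
  have hcl : IsClosed S := isClosed_Ici.inter (isClosed_le hf continuous_const)
  have hbdd : BddBelow S := ⟨0, fun t ht => ht.1⟩
  have hmem : sInf S ∈ S := hcl.csInf_mem ⟨s, hs0, hs⟩ hbdd
  have hlt : ∀ t, 0 ≤ t → t < sInf S → 0 < f t := by
    intro t ht hlt
    by_contra! hc
    exact absurd (csInf_le hbdd ⟨ht, hc⟩) (not_le.2 hlt)
  obtain ⟨r, hr, hr'⟩ := intermediate_value_Icc' hmem.1 hf.continuousOn ⟨hmem.2, h0.le⟩
  have hreq : r = sInf S := by
    refine le_antisymm hr.2 (csInf_le hbdd ⟨hr.1, hr'.le⟩)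
  refine ⟨sInf S, lt_of_le_of_ne hmem.1 ?_, hreq ▸ hr', hlt⟩
  intro hc
  rw [← hreq] at hc
  rw [← hc] at hr'
  exact h0.ne' hr'

/-! ### Energy, convergence to equilibria, and wells -/

/-- The energy of the pendulum. -/
noncomputable def energy (a : ℝ) (p : ℝ × ℝ) : ℝ := p.2 ^ 2 / 2 + a * (1 - Real.cos p.1)

theorem continuous_energy (a : ℝ) : Continuous (energy a) := by
  unfold energy
  fun_prop

theorem energy_nonneg {a : ℝ} (ha : 0 < a) (p : ℝ × ℝ) : 0 ≤ energy a p := by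
  have := Real.cos_le_one p.1
  have : 0 ≤ a * (1 - Real.cos p.1) := by apply mul_nonneg ha.le; linarith
  unfold energy
  positivity

/-- From `v² ≤ 2E ≤ (E + 1)²`; the crude bound avoids a square root. -/
theorem abs_snd_le_of_energy_le {a E : ℝ} (ha : 0 < a) {p : ℝ × ℝ} (h : energy a p ≤ E) :
    |p.2| ≤ E + 1 := by
  have h0 := (energy_nonneg ha p).trans h
  have := Real.cos_le_one p.1
  have h1 : 0 ≤ a * (1 - Real.cos p.1) := by apply mul_nonneg ha.le; linarith
  unfold energy at h
  apply abs_le_of_sq_le_sq _ (by linarith)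
  nlinarith

section

variable {a b : ℝ} {u : ℝ → ℝ × ℝ}

theorem IsPend.hasDerivAt_energy (hu : IsPend a b u) (t : ℝ) :
    HasDerivAt (fun t => energy a (u t)) (-(a * b * Real.sin (u t).1 ^ 2)) t := by
  have h1 := (((hu.hasDerivAt_snd t).pow 2).div_const 2).add
    (((hu.hasDerivAt_fst t).cos.const_sub 1).const_mul a)
  refine h1.congr_deriv ?_
  simp
  ring

theorem IsPend.antitone_energy (ha : 0 < a) (hb : 0 < b) (hu : IsPend a b u) :
    Antitone fun t => energy a (u t) :=
  antitone_of_hasDerivAt_nonpos hu.hasDerivAt_energy fun t => by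
    simp only [Pi.zero_apply]
    have : 0 ≤ a * b * Real.sin (u t).1 ^ 2 := by positivity
    linarith

/-- Every trajectory tends to an equilibrium. -/
theorem IsPend.exists_tendsto (ha : 0 < a) (hb : 0 < b) (hu : IsPend a b u) :
    ∃ k : ℤ, Tendsto u atTop (𝓝 ((k : ℝ) * Real.pi, 0)) := by
  have hanti := hu.antitone_energy ha hb
  have hE : Tendsto (fun t => energy a (u t)) atTop (𝓝 (⨅ t, energy a (u t))) :=
    tendsto_atTop_ciInf hanti ⟨0, by rintro _ ⟨t, rfl⟩; exact energy_nonneg ha _⟩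
  set M := energy a (u 0) + 1 with hM
  have hM0 : 0 ≤ M := by linarith [energy_nonneg ha (u 0)]
  have hv : ∀ t, 0 ≤ t → |(u t).2| ≤ M := fun t ht => abs_snd_le_of_energy_le ha (hanti ht)
  have hθ' : ∀ t, 0 ≤ t → |(u t).2 - b * Real.sin (u t).1| ≤ M + b := by
    intro t ht
    refine (abs_sub _ _).trans (add_le_add (hv t ht) ?_)
    rw [abs_mul, abs_of_pos hb]
    nlinarith [Real.abs_sin_le_one (u t).1]
  -- Barbalat is used twice: on the energy, which forces `sin θ → 0` and hence convergence of `θ`,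
  -- and below on `θ`, which forces `θ' → 0` and so `v → 0`.
  have hsq : Tendsto (fun t => -(a * b * Real.sin (u t).1 ^ 2)) atTop (𝓝 0) := by
    refine tendsto_deriv_zero_of_tendsto (C := a * b * 2 * (M + b)) hu.hasDerivAt_energy
      (fun t => ((((hu.hasDerivAt_fst t).sin.pow 2).const_mul (a * b)).neg)) ?_ hE
    intro t ht
    have h1 := Real.abs_sin_le_one (u t).1
    have h2 := Real.abs_cos_le_one (u t).1
    have h3 := hθ' t ht
    rw [abs_neg, abs_mul, abs_of_pos (mul_pos ha hb), mul_assoc (a * b) 2]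
    apply mul_le_mul_of_nonneg_left _ (by positivity)
    rw [abs_mul, abs_mul, abs_mul]
    have h4 : |Real.cos (u t).1| * |(u t).2 - b * Real.sin (u t).1| ≤ 1 * (M + b) := by gcongr
    have h5 : |((2 : ℕ) : ℝ)| * |Real.sin (u t).1 ^ (2 - 1)| ≤ 2 := by
      norm_num
      exact h1
    calc _ ≤ 2 * (1 * (M + b)) := by gcongr
      _ = _ := by ring
  have hsin : Tendsto (fun t => Real.sin (u t).1) atTop (𝓝 0) := by
    have h1 : Tendsto (fun t => Real.sin (u t).1 ^ 2) atTop (𝓝 0) := by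
      have := hsq.const_mul (-(1 / (a * b)))
      rw [mul_zero] at this
      refine this.congr fun t => ?_
      field_simp
    rw [tendsto_zero_iff_abs_tendsto_zero]
    have h2 := (Real.continuous_sqrt.tendsto 0).comp h1
    simpa [Function.comp_def, Real.sqrt_sq_eq_abs] using h2
  obtain ⟨k, hk⟩ := exists_tendsto_int_mul_pi (f := fun t => (u t).1)
    (continuous_fst.comp hu.continuous) hsin
  have hθ0 : Tendsto (fun t => (u t).2 - b * Real.sin (u t).1) atTop (𝓝 0) := by
    refine tendsto_deriv_zero_of_tendsto (C := a + b * (M + b)) hu.hasDerivAt_fst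
      (fun t => (hu.hasDerivAt_snd t).sub ((hu.hasDerivAt_fst t).sin.const_mul b)) ?_ hk
    intro t ht
    have h1 := Real.abs_sin_le_one (u t).1
    have h2 := Real.abs_cos_le_one (u t).1
    have h3 := hθ' t ht
    refine (abs_sub _ _).trans (add_le_add ?_ ?_)
    · rw [abs_neg, abs_mul, abs_of_pos ha]
      nlinarith
    · rw [abs_mul, abs_mul, abs_of_pos hb]
      apply mul_le_mul_of_nonneg_left _ hb.le
      calc _ ≤ 1 * (M + b) := by gcongr
        _ = _ := one_mul _
  refine ⟨k, hk.prodMk_nhds ?_⟩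
  simpa using hθ0.add (hsin.const_mul b)

theorem int_eq_of_tendsto {k m : ℤ} (hk : Tendsto u atTop (𝓝 ((k : ℝ) * Real.pi, 0)))
    (hm : Tendsto u atTop (𝓝 ((m : ℝ) * Real.pi, 0))) : k = m := by
  have h := congrArg Prod.fst (tendsto_nhds_unique hk hm)
  exact_mod_cast mul_right_cancel₀ Real.pi_pos.ne' h

theorem cos_eq_neg_one_of_abs_sub_eq_pi {x : ℝ} {m : ℤ}
    (h : |x - ((2 * m : ℤ) : ℝ) * Real.pi| = Real.pi) : Real.cos x = -1 := by
  have h1 : x - ((2 * m : ℤ) : ℝ) * Real.pi = x - m * (2 * Real.pi) := by push_cast; ring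
  rw [← Real.cos_sub_int_mul_two_pi x m, ← h1, ← Real.cos_abs, h, Real.cos_pi]

theorem exists_abs_sub_lt_pi {x : ℝ} (h : Real.cos x ≠ -1) :
    ∃ m : ℤ, |x - ((2 * m : ℤ) : ℝ) * Real.pi| < Real.pi := by
  have hπ := Real.pi_pos
  refine ⟨round (x / (2 * Real.pi)), lt_of_le_of_ne ?_
    fun hc => h (cos_eq_neg_one_of_abs_sub_eq_pi hc)⟩
  have h1 := abs_sub_round (x / (2 * Real.pi))
  have h2 : x - ((2 * round (x / (2 * Real.pi)) : ℤ) : ℝ) * Real.pi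
      = (x / (2 * Real.pi) - round (x / (2 * Real.pi))) * (2 * Real.pi) := by
    push_cast
    field_simp
  rw [h2, abs_mul, abs_of_pos (by positivity : (0 : ℝ) < 2 * Real.pi)]
  nlinarith

/-- Below the energy of the saddles, a trajectory stays in its well and tends to its bottom. -/
theorem IsPend.trapped (ha : 0 < a) (hb : 0 < b) (hu : IsPend a b u) {t₁ : ℝ} {m : ℤ}
    (hE : energy a (u t₁) < 2 * a) (hm : |(u t₁).1 - ((2 * m : ℤ) : ℝ) * Real.pi| < Real.pi) :
    (∀ t, t₁ ≤ t → |(u t).1 - ((2 * m : ℤ) : ℝ) * Real.pi| < Real.pi) ∧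
      Tendsto u atTop (𝓝 (((2 * m : ℤ) : ℝ) * Real.pi, 0)) := by
  have hπ := Real.pi_pos
  have hanti := hu.antitone_energy ha hb
  -- On the edges of a well the potential alone is already `2a`.
  have hcos : ∀ p : ℝ × ℝ, energy a p < 2 * a → Real.cos p.1 ≠ -1 := by
    intro p hp hc
    unfold energy at hp
    rw [hc] at hp
    nlinarith [sq_nonneg p.2]
  have hstay : ∀ t, t₁ ≤ t → |(u t).1 - ((2 * m : ℤ) : ℝ) * Real.pi| < Real.pi := by
    intro t ht
    by_contra! hc
    have hcu := hu.continuous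
    have hcont : ContinuousOn (fun t => |(u t).1 - ((2 * m : ℤ) : ℝ) * Real.pi|) (Icc t₁ t) := by
      fun_prop
    obtain ⟨s, hs, hs'⟩ := intermediate_value_Icc ht hcont ⟨hm.le, hc⟩
    exact hcos (u s) ((hanti hs.1).trans_lt hE) (cos_eq_neg_one_of_abs_sub_eq_pi hs')
  refine ⟨hstay, ?_⟩
  obtain ⟨k, hk⟩ := hu.exists_tendsto ha hb
  have hElim := ((continuous_energy a).tendsto _).comp hk
  have hEk : energy a ((k : ℝ) * Real.pi, 0) ≤ energy a (u t₁) := by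
    refine le_of_tendsto hElim ?_
    filter_upwards [eventually_ge_atTop t₁] with t ht using hanti ht
  have hck := hcos _ (hEk.trans_lt hE)
  have hθ : |(k : ℝ) * Real.pi - ((2 * m : ℤ) : ℝ) * Real.pi| ≤ Real.pi := by
    have h1 : Tendsto (fun t => |(u t).1 - ((2 * m : ℤ) : ℝ) * Real.pi|) atTop
        (𝓝 |(k : ℝ) * Real.pi - ((2 * m : ℤ) : ℝ) * Real.pi|) :=
      (((continuous_fst.tendsto _).comp hk).sub_const _).abs
    refine le_of_tendsto h1 ?_
    filter_upwards [eventually_ge_atTop t₁] with t ht using (hstay t ht).le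
  have hlt : |(k : ℝ) * Real.pi - ((2 * m : ℤ) : ℝ) * Real.pi| < Real.pi :=
    lt_of_le_of_ne hθ fun hc => hck (cos_eq_neg_one_of_abs_sub_eq_pi hc)
  rw [← sub_mul, abs_mul, abs_of_pos hπ, mul_lt_iff_lt_one_left hπ] at hlt
  have : |k - 2 * m| < 1 := by exact_mod_cast hlt
  have : k = 2 * m := by have := Int.abs_lt_one_iff.1 this; omega
  rwa [this] at hk

theorem isPend_const {p : ℝ × ℝ} (h1 : Real.sin p.1 = 0) (h2 : p.2 = 0) :
    IsPend a b fun _ => p := by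
  intro t
  refine (hasDerivAt_const t p).congr_deriv ?_
  ext <;> simp [pendField, h1, h2]

/-! ### Trajectories in the upper half plane -/

/-- A trajectory that starts with `v > 0` keeps `v > 0`, or falls into a well. -/
theorem IsPend.pos_or_trapped (ha : 0 < a) (hb : 0 < b) (hu : IsPend a b u) (h0 : 0 < (u 0).2) :
    (∀ t, 0 ≤ t → 0 < (u t).2) ∨ ∃ t₁, 0 < t₁ ∧ (∀ t, 0 ≤ t → t < t₁ → 0 < (u t).2) ∧
      ∃ m : ℤ, (∀ t, t₁ ≤ t → |(u t).1 - ((2 * m : ℤ) : ℝ) * Real.pi| < Real.pi) ∧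
        Tendsto u atTop (𝓝 (((2 * m : ℤ) : ℝ) * Real.pi, 0)) := by
  refine (forall_pos_or_exists_first_zero (continuous_snd.comp hu.continuous) h0).imp_right ?_
  rintro ⟨t₁, ht₁, hv, hpos⟩
  have hv : (u t₁).2 = 0 := hv
  refine ⟨t₁, ht₁, hpos, ?_⟩
  -- Otherwise `u t₁` would be a saddle and `u` constant by uniqueness. So at the moment `v = 0` the
  -- energy is strictly below `2a`.
  have hcos : Real.cos (u t₁).1 ≠ -1 := by
    intro hc
    have hsin : Real.sin (u t₁).1 = 0 := by
      have := Real.sin_sq_add_cos_sq (u t₁).1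
      rw [hc] at this
      nlinarith
    have h := hu.eq_of_eq ha hb (isPend_const hsin hv) (t₀ := t₁) rfl
    rw [h] at h0
    exact h0.ne' hv
  obtain ⟨m, hm⟩ := exists_abs_sub_lt_pi hcos
  refine ⟨m, hu.trapped ha hb ?_ hm⟩
  unfold energy
  rw [hv]
  have := lt_of_le_of_ne (Real.neg_one_le_cos (u t₁).1) hcos.symm
  nlinarith

/-- On the line `θ = kπ` the damping term vanishes and `θ' = v > 0`, so the line is a one-way
barrier. -/
theorem IsPend.le_fst (hu : IsPend a b u) {k : ℤ} {T : ℝ}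
    (hpos : ∀ t, 0 ≤ t → t < T → 0 < (u t).2) (h : k * Real.pi ≤ (u 0).1) {t : ℝ}
    (ht : 0 ≤ t) (htT : t ≤ T) : k * Real.pi ≤ (u t).1 := by
  refine image_le_of_deriv_right_lt_deriv_boundary (f := fun _ => k * Real.pi) (f' := fun _ => 0)
    (a := 0) (b := T) continuousOn_const (fun s _ => hasDerivWithinAt_const s _ _) h
    hu.hasDerivAt_fst ?_ ⟨ht, htT⟩
  intro s hs hsk
  have hsin : Real.sin (u s).1 = 0 := by
    rw [← hsk]
    exact Real.sin_int_mul_pi k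
  rw [hsin, mul_zero, sub_zero]
  exact hpos s hs.1 hs.2

/-- If `v` stays positive, the barrier passes to the limit. If the trajectory falls into the well of
`2j`, then `kπ ≤ θ < (2j + 1)π` at that moment, so `k ≤ 2j`. -/
theorem IsPend.le_of_tendsto (ha : 0 < a) (hb : 0 < b) (hu : IsPend a b u) {k m : ℤ}
    (h0 : 0 < (u 0).2) (h : k * Real.pi ≤ (u 0).1)
    (hm : Tendsto u atTop (𝓝 ((m : ℝ) * Real.pi, 0))) : k ≤ m := by
  have hπ := Real.pi_pos
  rcases hu.pos_or_trapped ha hb h0 with hpos | ⟨t₁, ht₁, hpos, j, hj, hlim⟩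
  · have h1 : k * Real.pi ≤ m * Real.pi := by
      refine ge_of_tendsto ((continuous_fst.tendsto _).comp hm) ?_
      filter_upwards [eventually_ge_atTop 0] with t ht
      exact hu.le_fst (T := t) (fun s hs _ => hpos s hs) h ht le_rfl
    exact_mod_cast le_of_mul_le_mul_right h1 hπ
  · have hmj := int_eq_of_tendsto hm hlim
    have h1 := hu.le_fst hpos h ht₁.le le_rfl
    have h2 := (abs_lt.1 (hj t₁ le_rfl)).2
    have h3 : (k : ℝ) * Real.pi < (2 * j + 1 : ℤ) * Real.pi := by
      push_cast at h2 ⊢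
      linarith
    have h4 : k < 2 * j + 1 := by exact_mod_cast lt_of_mul_lt_mul_right h3 hπ.le
    omega

/-- Crossing the saddle's phase upwards means slipping into a later well. -/
theorem IsPend.two_le_of_tendsto (ha : 0 < a) (hb : 0 < b) (hu : IsPend a b u) {m : ℤ}
    (h0 : 0 < (u 0).2) (h : Real.pi ≤ (u 0).1)
    (hm : Tendsto u atTop (𝓝 ((m : ℝ) * Real.pi, 0))) : 2 ≤ m := by
  have hπ := Real.pi_pos
  have h' : ((1 : ℤ) : ℝ) * Real.pi ≤ (u 0).1 := by simpa using h
  have h1 := hu.le_of_tendsto ha hb h0 h' hm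
  by_contra hc
  have hm1 : m = 1 := by omega
  subst hm1
  rcases hu.pos_or_trapped ha hb h0 with hpos | ⟨t₁, ht₁, hpos, j, hj, hlim⟩
  -- Approaching the saddle from phases in `[π, 2π)`, `sin θ ≤ 0` makes `v` nondecreasing, so a
  -- positive `v` cannot tend to `0`.
  · have hge : ∀ t, 0 ≤ t → Real.pi ≤ (u t).1 := fun t ht => by
      simpa using hu.le_fst (k := 1) (T := t) (fun s hs _ => hpos s hs) h' ht le_rfl
    have h2 : ∀ᶠ t in atTop, (u t).1 < 2 * Real.pi :=
      ((continuous_fst.tendsto _).comp hm).eventually_lt_const (by simp; linarith)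
    obtain ⟨N, hN⟩ := (h2.and (eventually_ge_atTop 0)).exists_forall_of_atTop
    have hmono : MonotoneOn (fun t => (u t).2) (Ici N) := by
      apply monotoneOn_of_hasDerivWithinAt_nonneg (convex_Ici N)
        (continuous_snd.comp hu.continuous).continuousOn
        (fun t _ => (hu.hasDerivAt_snd t).hasDerivWithinAt)
      intro t ht
      rw [interior_Ici] at ht
      have h3 := hN t (le_of_lt ht)
      have h4 := hge t h3.2
      have h5 : Real.sin (u t).1 ≤ 0 := by
        rw [← neg_nonneg, ← Real.sin_sub_pi]
        exact Real.sin_nonneg_of_nonneg_of_le_pi (by linarith) (by linarith)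
      nlinarith
    have h3 : (u N).2 ≤ 0 := by
      refine ge_of_tendsto ((continuous_snd.tendsto _).comp hm) ?_
      filter_upwards [eventually_ge_atTop N] with t ht
      exact hmono (mem_Ici.2 le_rfl) ht ht
    exact absurd (hpos N (hN N le_rfl).2) (not_lt.2 h3)
  · have := int_eq_of_tendsto hm hlim
    omega

end

/-! ### The stable branch of the saddle as a graph over the phase -/

section

variable {a b : ℝ} {u w : ℝ → ℝ × ℝ}

/-- `u` runs on the branch of the stable manifold of the saddle `(π, 0)` that lies in `v > 0` and
starts over `[0, π)`. -/
structure IsSep (a b : ℝ) (u : ℝ → ℝ × ℝ) : Prop where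
  isPend : IsPend a b u
  nonneg : 0 ≤ (u 0).1
  lt_pi : (u 0).1 < Real.pi
  pos : ∀ t, 0 ≤ t → 0 < (u t).2
  tendsto : Tendsto u atTop (𝓝 (Real.pi, 0))

/-- The lower bound is the barrier at `0`; reaching `π` with `v > 0` would force a limit beyond the
saddle. -/
theorem IsSep.fst_mem (ha : 0 < a) (hb : 0 < b) (hu : IsSep a b u) {t : ℝ} (ht : 0 ≤ t) :
    (u t).1 ∈ Ico 0 Real.pi := by
  constructor
  · have h0 : ((0 : ℤ) : ℝ) * Real.pi ≤ (u 0).1 := by simpa using hu.nonneg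
    simpa using hu.isPend.le_fst (T := t) (fun s hs _ => hu.pos s hs) h0 ht le_rfl
  · by_contra! hc
    have h1 : Tendsto (fun s => u (s + t)) atTop (𝓝 (((1 : ℤ) : ℝ) * Real.pi, 0)) := by
      simpa [Function.comp_def] using hu.tendsto.comp (tendsto_atTop_add_const_right atTop t tendsto_id)
    have := (hu.isPend.comp_add t).two_le_of_tendsto ha hb (by simpa using hu.pos t ht)
      (by simpa using hc) h1
    omega

/-- Where `θ' = 0` on the branch, `θ'' = -a sin θ < 0`; hence `θ' ≤ 0` would persist, and `θ` could
no longer climb to `π`. -/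
theorem IsSep.deriv_fst_pos (ha : 0 < a) (hb : 0 < b) (hu : IsSep a b u) {t : ℝ} (ht : 0 ≤ t) :
    0 < (u t).2 - b * Real.sin (u t).1 := by
  by_contra! hc
  have hle : ∀ s, t ≤ s → (u s).2 - b * Real.sin (u s).1 ≤ 0 := by
    intro s hs
    refine image_le_of_deriv_right_lt_deriv_boundary (a := t) (b := s)
      (f := fun r => (u r).2 - b * Real.sin (u r).1) (B := fun _ => 0) (B' := fun _ => 0)
      (fun r _ => ?_)
      (fun r _ => ((hu.isPend.hasDerivAt_snd r).sub
        ((hu.isPend.hasDerivAt_fst r).sin.const_mul b)).hasDerivWithinAt) hc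
      (fun r => hasDerivAt_const r 0) ?_ ⟨hs, le_rfl⟩
    · exact (((hu.isPend.hasDerivAt_snd r).sub
        ((hu.isPend.hasDerivAt_fst r).sin.const_mul b))).continuousAt.continuousWithinAt
    · intro r hr hr0
      have hr' := ht.trans hr.1
      rw [hr0, mul_zero, mul_zero, sub_zero]
      have h1 := hu.fst_mem ha hb hr'
      have h2 : 0 < (u r).1 := by
        refine lt_of_le_of_ne h1.1 fun h => ?_
        rw [← h, Real.sin_zero, mul_zero, sub_zero] at hr0
        exact (hu.pos r hr').ne' hr0
      have := Real.sin_pos_of_pos_of_lt_pi h2 h1.2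
      nlinarith
  have hanti : AntitoneOn (fun s => (u s).1) (Ici t) := by
    apply antitoneOn_of_hasDerivWithinAt_nonpos (convex_Ici t)
      (continuous_fst.comp hu.isPend.continuous).continuousOn
      (fun s _ => (hu.isPend.hasDerivAt_fst s).hasDerivWithinAt)
    intro s hs
    rw [interior_Ici] at hs
    exact hle s (le_of_lt hs)
  have h1 : Real.pi ≤ (u t).1 := by
    refine le_of_tendsto ((continuous_fst.tendsto _).comp hu.tendsto) ?_
    filter_upwards [eventually_ge_atTop t] with s hs
    exact hanti (mem_Ici.2 le_rfl) hs hs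
  exact absurd (hu.fst_mem ha hb ht).2 (not_lt.2 h1)

theorem IsSep.strictMonoOn_fst (ha : 0 < a) (hb : 0 < b) (hu : IsSep a b u) :
    StrictMonoOn (fun t => (u t).1) (Ici 0) := by
  apply strictMonoOn_of_hasDerivWithinAt_pos (convex_Ici 0)
    (continuous_fst.comp hu.isPend.continuous).continuousOn
    (fun s _ => (hu.isPend.hasDerivAt_fst s).hasDerivWithinAt)
  intro s hs
  rw [interior_Ici] at hs
  exact hu.deriv_fst_pos ha hb (le_of_lt hs)

theorem IsSep.image_fst (ha : 0 < a) (hb : 0 < b) (hu : IsSep a b u) :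
    (fun t => (u t).1) '' Ici 0 = Ico (u 0).1 Real.pi := by
  apply Subset.antisymm
  · rintro _ ⟨t, ht, rfl⟩
    exact ⟨(hu.strictMonoOn_fst ha hb).monotoneOn (mem_Ici.2 le_rfl) ht ht,
      (hu.fst_mem ha hb ht).2⟩
  · rintro y ⟨hy0, hy1⟩
    have h1 : ∀ᶠ t in atTop, y < (u t).1 :=
      ((continuous_fst.tendsto _).comp hu.tendsto).eventually_const_lt hy1
    obtain ⟨t, ht, ht0⟩ := (h1.and (eventually_ge_atTop 0)).exists
    obtain ⟨s, hs, hs'⟩ := intermediate_value_Icc ht0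
      (continuous_fst.comp hu.isPend.continuous).continuousOn ⟨hy0, ht.le⟩
    exact ⟨s, hs.1, hs'⟩

/-- Along the upper branch the phase can be inverted: `T y` is the time at which the phase is
`y`. -/
theorem IsSep.exists_time (ha : 0 < a) (hb : 0 < b) (hu : IsSep a b u) :
    ∃ T : ℝ → ℝ, (∀ y ∈ Ico (u 0).1 Real.pi, 0 ≤ T y ∧ (u (T y)).1 = y) ∧
      (∀ t, 0 ≤ t → T (u t).1 = t) ∧ ContinuousOn T (Ico (u 0).1 Real.pi) ∧
      ∀ y ∈ Ioo (u 0).1 Real.pi,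
        HasDerivAt T ((u (T y)).2 - b * Real.sin y)⁻¹ y := by
  have himg := hu.image_fst ha hb
  have hmono := hu.strictMonoOn_fst ha hb
  set T := Function.invFunOn (fun t => (u t).1) (Ici 0) with hT
  have h1 : ∀ y ∈ Ico (u 0).1 Real.pi, 0 ≤ T y ∧ (u (T y)).1 = y := by
    intro y hy
    rw [← himg] at hy
    exact ⟨Function.invFunOn_mem hy, Function.invFunOn_eq hy⟩
  have h2 : ∀ t, 0 ≤ t → T (u t).1 = t := fun t ht =>
    hmono.injOn.leftInvOn_invFunOn ht
  have hTmono : StrictMonoOn T (Ico (u 0).1 Real.pi) := by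
    intro y hy z hz hyz
    by_contra! hc
    have := hmono.monotoneOn (h1 z hz).1 (h1 y hy).1 hc
    simp only [(h1 z hz).2, (h1 y hy).2] at this
    linarith
  have hTimg : T '' Ico (u 0).1 Real.pi = Ici 0 := by
    apply Subset.antisymm
    · rintro _ ⟨y, hy, rfl⟩
      exact (h1 y hy).1
    · intro t ht
      exact ⟨(u t).1, himg ▸ mem_image_of_mem _ ht, h2 t ht⟩
  have hcontAt : ∀ y ∈ Ioo (u 0).1 Real.pi, ContinuousAt T y := by
    intro y hy
    apply hTmono.continuousAt_of_image_mem_nhds (Ico_mem_nhds hy.1 hy.2)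
    rw [hTimg]
    apply Ici_mem_nhds
    have := hTmono ⟨le_rfl, hu.lt_pi⟩ ⟨hy.1.le, hy.2⟩ hy.1
    rwa [h2 0 le_rfl] at this
  refine ⟨T, h1, h2, ?_, ?_⟩
  · intro y hy
    rcases hy.1.eq_or_lt with h | h
    · rw [← h]
      refine (hTmono.continuousWithinAt_right_of_image_mem_nhdsWithin
        (Ico_mem_nhdsGE hu.lt_pi) ?_).mono Ico_subset_Ici_self
      rw [hTimg, h2 0 le_rfl]
      exact self_mem_nhdsWithin
    · exact (hcontAt y ⟨h, hy.2⟩).continuousWithinAt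
  · intro y hy
    have hy' := h1 y ⟨hy.1.le, hy.2⟩
    have hd := hu.isPend.hasDerivAt_fst (T y)
    have hpos := hu.deriv_fst_pos ha hb hy'.1
    rw [hy'.2] at hd hpos
    refine HasDerivAt.of_local_left_inverse (hcontAt y hy) hd hpos.ne' ?_
    filter_upwards [Ioo_mem_nhds hy.1 hy.2] with z hz using (h1 z ⟨hz.1.le, hz.2⟩).2

/-- The upper branch meets each vertical line over `[0, π)` at most once. -/
theorem IsSep.snd_eq (ha : 0 < a) (hb : 0 < b) (hu : IsSep a b u) (hw : IsSep a b w)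
    (h : (u 0).1 = (w 0).1) : (u 0).2 = (w 0).2 := by
  obtain ⟨T, hT, hTu, hTc, hTd⟩ := hu.exists_time ha hb
  have hmem : ∀ t, 0 ≤ t → (w t).1 ∈ Ico (u 0).1 Real.pi := fun t ht => by
    rw [h, ← hw.image_fst ha hb]
    exact mem_image_of_mem _ ht
  -- The height of `w` minus that of `u` at the same phase. Along `w` it satisfies `f' = a sin θ · f
  -- / θ'`, with `θ'` the phase velocity of `u`, so `f²` is nondecreasing. As it tends to `0`, it
  -- vanishes.
  set f : ℝ → ℝ := fun t => (w t).2 - (u (T (w t).1)).2 with hf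
  have hfc : ContinuousOn f (Ici 0) := by
    have h1 : ContinuousOn (fun t => T (w t).1) (Ici 0) :=
      hTc.comp (continuous_fst.comp hw.isPend.continuous).continuousOn hmem
    exact (continuous_snd.comp hw.isPend.continuous).continuousOn.sub
      ((continuous_snd.comp hu.isPend.continuous).comp_continuousOn h1)
  have hfd : ∀ t, 0 < t → HasDerivAt f (a * Real.sin (w t).1 * f t /
      ((u (T (w t).1)).2 - b * Real.sin (w t).1)) t := by
    intro t ht
    have hy : (w t).1 ∈ Ioo (u 0).1 Real.pi := by
      refine ⟨?_, (hmem t ht.le).2⟩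
      rw [h]
      exact hw.strictMonoOn_fst ha hb (mem_Ici.2 le_rfl) ht.le ht
    have hTy := hT _ (hmem t ht.le)
    have hpos := hu.deriv_fst_pos ha hb hTy.1
    have h1 := (hu.isPend.hasDerivAt_snd (T (w t).1)).comp t
      ((hTd _ hy).comp t (hw.isPend.hasDerivAt_fst t))
    refine ((hw.isPend.hasDerivAt_snd t).sub h1).congr_deriv ?_
    rw [hTy.2] at hpos ⊢
    have hne := hpos.ne'
    simp only [hf]
    generalize hD : (u (T (w t).1)).2 - b * Real.sin (w t).1 = D at hne ⊢
    rw [show (u (T (w t).1)).2 = D + b * Real.sin (w t).1 by linarith]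
    field_simp
    ring
  have hmono : MonotoneOn (fun t => f t ^ 2) (Ici 0) := by
    apply monotoneOn_of_hasDerivWithinAt_nonneg (convex_Ici 0) (hfc.pow 2)
      (f' := fun t => 2 * (a * Real.sin (w t).1 * f t ^ 2 /
        ((u (T (w t).1)).2 - b * Real.sin (w t).1)))
    · intro t ht
      rw [interior_Ici] at ht
      refine ((hfd t ht).pow 2).hasDerivWithinAt.congr_deriv ?_
      push_cast
      ring
    · intro t ht
      rw [interior_Ici] at ht
      have hTy := hT _ (hmem t (le_of_lt ht))
      have hpos := hu.deriv_fst_pos ha hb hTy.1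
      rw [hTy.2] at hpos
      have h1 := hw.fst_mem ha hb (le_of_lt ht)
      have := Real.sin_nonneg_of_nonneg_of_le_pi h1.1 h1.2.le
      positivity
  have hTtop : Tendsto (fun t => T (w t).1) atTop atTop := by
    rw [tendsto_atTop]
    intro N
    have h1 := (hu.fst_mem ha hb (le_max_right N 0)).2
    filter_upwards [((continuous_fst.tendsto _).comp hw.tendsto).eventually_const_lt h1,
      eventually_ge_atTop 0] with t ht ht0
    have hTy := hT _ (hmem t ht0)
    by_contra! hc
    have h2 := (hu.strictMonoOn_fst ha hb).monotoneOn hTy.1 (le_max_right N 0)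
      (hc.le.trans (le_max_left N 0))
    simp only [hTy.2] at h2
    exact absurd ht (not_lt.2 h2)
  have hf0 : Tendsto (fun t => f t ^ 2) atTop (𝓝 0) := by
    have h1 : Tendsto (fun t => (w t).2) atTop (𝓝 0) := (continuous_snd.tendsto _).comp hw.tendsto
    have h2 : Tendsto (fun t => (u (T (w t).1)).2) atTop (𝓝 0) :=
      ((continuous_snd.tendsto _).comp hu.tendsto).comp hTtop
    simpa using (h1.sub h2).pow 2
  have h1 : f 0 ^ 2 ≤ 0 := by
    refine ge_of_tendsto hf0 ?_
    filter_upwards [eventually_ge_atTop 0] with t ht using hmono (mem_Ici.2 le_rfl) ht ht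
  have h2 : f 0 = 0 := by nlinarith
  have h3 : T (w 0).1 = 0 := by rw [← h]; exact hTu 0 le_rfl
  simp only [hf, h3] at h2
  linarith

end

/-! ### The critical height, by connectedness -/

section

variable {a b : ℝ} {u w : ℝ → ℝ × ℝ}

theorem IsPend.two_le_of_crossing (ha : 0 < a) (hb : 0 < b) (hu : IsPend a b u) {T : ℝ}
    (hθ : Real.pi < (u T).1) (hv : 0 < (u T).2) :
    ∃ m : ℤ, 2 ≤ m ∧ Tendsto u atTop (𝓝 ((m : ℝ) * Real.pi, 0)) := by
  obtain ⟨m, hm⟩ := hu.exists_tendsto ha hb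
  refine ⟨m, (hu.comp_add T).two_le_of_tendsto ha hb (by simpa using hv)
    (by simpa using hθ.le) ?_, hm⟩
  exact hm.comp (tendsto_atTop_add_const_right atTop T tendsto_id)

/-- Converse of `two_le_of_crossing`: a limit beyond the saddle is detected by a strict inequality
at a finite time, hence is an open condition on the initial point. -/
theorem IsPend.exists_crossing (ha : 0 < a) (hb : 0 < b) (hu : IsPend a b u) {m : ℤ}
    (h0 : 0 < (u 0).2) (hm2 : 2 ≤ m) (hm : Tendsto u atTop (𝓝 ((m : ℝ) * Real.pi, 0))) :
    ∃ T, 0 ≤ T ∧ Real.pi < (u T).1 ∧ 0 < (u T).2 := by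
  have hπ := Real.pi_pos
  have hm2' : (2 : ℝ) ≤ m := by exact_mod_cast hm2
  rcases hu.pos_or_trapped ha hb h0 with hpos | ⟨t₁, ht₁, hpos, j, hj, hlim⟩
  · have h1 : ∀ᶠ t in atTop, Real.pi < (u t).1 :=
      ((continuous_fst.tendsto _).comp hm).eventually_const_lt (by simp only; nlinarith)
    obtain ⟨T, hT, hT0⟩ := (h1.and (eventually_ge_atTop 0)).exists
    exact ⟨T, hT0, hT, hpos T hT0⟩
  · rw [← int_eq_of_tendsto hm hlim] at hj
    have h1 : Real.pi < (u t₁).1 := by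
      have := (abs_lt.1 (hj t₁ le_rfl)).1
      nlinarith
    -- Positivity of `v` is known only before `t₁`, so the crossing is taken slightly earlier.
    have h2 : ∀ᶠ t in 𝓝[<] t₁, Real.pi < (u t).1 :=
      ((continuous_fst.comp hu.continuous).tendsto t₁).mono_left nhdsWithin_le_nhds
        |>.eventually_const_lt h1
    obtain ⟨T, hT, hT'⟩ := (h2.and (Ioo_mem_nhdsLT ht₁)).exists
    exact ⟨T, hT'.1.le, hT, hpos T hT'.1.le hT'.2⟩

theorem IsPend.isSep (ha : 0 < a) (hb : 0 < b) (hu : IsPend a b u) (h0 : 0 < (u 0).2)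
    (hθ0 : 0 ≤ (u 0).1) (hθπ : (u 0).1 < Real.pi)
    (h : Tendsto u atTop (𝓝 (((1 : ℤ) : ℝ) * Real.pi, 0))) : IsSep a b u := by
  refine ⟨hu, hθ0, hθπ, ?_, by simpa using h⟩
  refine (hu.pos_or_trapped ha hb h0).resolve_right ?_
  rintro ⟨t₁, -, -, j, -, hlim⟩
  have := int_eq_of_tendsto h hlim
  omega

/-- In unit time `v` loses at most `a`, so `v ≥ b + 4` and `θ' ≥ 4 > π` throughout. -/
theorem IsPend.crossing_of_large (ha : 0 < a) (hb : 0 < b) (hu : IsPend a b u)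
    (hθ0 : 0 ≤ (u 0).1) (h0 : a + b + 4 ≤ (u 0).2) :
    Real.pi < (u 1).1 ∧ 0 < (u 1).2 := by
  have hv : Monotone fun t => (u t).2 + a * t := by
    apply monotone_of_hasDerivAt_nonneg
      (fun t => (hu.hasDerivAt_snd t).add ((hasDerivAt_id t).const_mul a))
    intro t
    simp only [Pi.zero_apply]
    nlinarith [Real.sin_le_one (u t).1]
  have hv' : ∀ t, 0 ≤ t → t ≤ 1 → b + 4 ≤ (u t).2 := by
    intro t ht ht1
    have := hv ht
    simp only [mul_zero, add_zero] at this
    nlinarith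
  have hθ : MonotoneOn (fun t => (u t).1 - 4 * t) (Icc 0 1) := by
    have hd : ∀ t, HasDerivAt (fun t => (u t).1 - 4 * t)
        ((u t).2 - b * Real.sin (u t).1 - 4 * 1) t :=
      fun t => (hu.hasDerivAt_fst t).sub ((hasDerivAt_id t).const_mul 4)
    apply monotoneOn_of_hasDerivWithinAt_nonneg (convex_Icc 0 1)
      (fun t _ => (hd t).continuousAt.continuousWithinAt)
      (fun t _ => (hd t).hasDerivWithinAt)
    intro t ht
    rw [interior_Icc] at ht
    have := hv' t ht.1.le ht.2.le
    nlinarith [Real.sin_le_one (u t).1]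
  have h1 := hθ (left_mem_Icc.2 zero_le_one) (right_mem_Icc.2 zero_le_one) zero_le_one
  have h2 := hv' 1 zero_le_one le_rfl
  simp only [mul_zero, sub_zero, mul_one] at h1
  constructor <;> linarith [Real.pi_lt_four]

/-- On every vertical line over `[0, π)` there is a critical height: on it the trajectory tends to
the saddle, below it to the bottom of its own well, above it to a later equilibrium. -/
theorem exists_critical_height (ha : 0 < a) (hb : 0 < b) {θ₀ : ℝ} (hθ0 : 0 ≤ θ₀)
    (hθπ : θ₀ < Real.pi) : ∃ V, 0 < V ∧ (∃ u, IsSep a b u ∧ u 0 = (θ₀, V)) ∧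
      (∀ u, IsPend a b u → (u 0).1 = θ₀ → 0 < (u 0).2 → (u 0).2 < V →
        Tendsto u atTop (𝓝 (0, 0))) ∧
      ∀ u, IsPend a b u → (u 0).1 = θ₀ → V < (u 0).2 →
        ∃ m : ℤ, 2 ≤ m ∧ Tendsto u atTop (𝓝 ((m : ℝ) * Real.pi, 0)) := by
  have hπ := Real.pi_pos
  choose φ hφ0 hφ using fun v : ℝ => exists_isPend ha hb (θ₀, v)
  have hcont : ∀ T, 0 ≤ T → Continuous fun v => φ v T := by
    intro T hT
    apply LipschitzWith.continuous (K := Real.toNNReal (Real.exp ((1 + a + b) * T)))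
    apply LipschitzWith.of_dist_le_mul
    intro v w
    have := (hφ v).dist_le ha hb (hφ w) hT
    rw [hφ0, hφ0, Prod.dist_eq (x := (θ₀, v)), dist_self, max_eq_right dist_nonneg] at this
    rwa [Real.coe_toNNReal _ (Real.exp_pos _).le, mul_comm]
  -- `A` and `B` test a later limit and the own well at finite times; both are open by continuous
  -- dependence on `v`.
  set A : Set ℝ := {v | ∃ T, 0 ≤ T ∧ Real.pi < (φ v T).1 ∧ 0 < (φ v T).2} with hA
  set B : Set ℝ := {v | ∃ T, 0 ≤ T ∧ |(φ v T).1| < Real.pi ∧ energy a (φ v T) < 2 * a} with hB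
  have hAo : IsOpen A := by
    have : A = ⋃ T ∈ Ici (0 : ℝ), {v | Real.pi < (φ v T).1 ∧ 0 < (φ v T).2} := by
      ext v; simp only [hA, mem_iUnion, mem_ofPred_eq, mem_Ici, exists_prop]
    rw [this]
    refine isOpen_biUnion fun T hT => ?_
    have := hcont T hT
    exact (isOpen_lt continuous_const (continuous_fst.comp this)).inter
      (isOpen_lt continuous_const (continuous_snd.comp this))
  have hBo : IsOpen B := by
    have : B = ⋃ T ∈ Ici (0 : ℝ), {v | |(φ v T).1| < Real.pi ∧ energy a (φ v T) < 2 * a} := by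
      ext v; simp only [hB, mem_iUnion, mem_ofPred_eq, mem_Ici, exists_prop]
    rw [this]
    refine isOpen_biUnion fun T hT => ?_
    have := hcont T hT
    exact (isOpen_lt (continuous_fst.comp this).abs continuous_const).inter
      (isOpen_lt ((continuous_energy a).comp this) continuous_const)
  have hBlim : ∀ v ∈ B, Tendsto (φ v) atTop (𝓝 (((0 : ℤ) : ℝ) * Real.pi, 0)) := by
    rintro v ⟨T, -, h1, h2⟩
    simpa using ((hφ v).trapped ha hb (m := 0) h2 (by simpa using h1)).2
  have hAlim : ∀ v ∈ A, ∃ m : ℤ, 2 ≤ m ∧ Tendsto (φ v) atTop (𝓝 ((m : ℝ) * Real.pi, 0)) := by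
    rintro v ⟨T, -, h1, h2⟩
    exact (hφ v).two_le_of_crossing ha hb h1 h2
  have hdisj : Disjoint B A := by
    rw [Set.disjoint_left]
    intro v hvB hvA
    obtain ⟨m, hm, hlim⟩ := hAlim v hvA
    have := int_eq_of_tendsto hlim (hBlim v hvB)
    omega
  have htri : ∀ v, 0 < v → v ∈ B ∪ A ∨ IsSep a b (φ v) := by
    intro v hv
    have hv0 : 0 < (φ v 0).2 := by rw [hφ0]; exact hv
    obtain ⟨k, hk⟩ := (hφ v).exists_tendsto ha hb
    have hk0 : 0 ≤ k := (hφ v).le_of_tendsto ha hb hv0 (by simpa [hφ0] using hθ0) hk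
    rcases (by omega : k = 0 ∨ k = 1 ∨ 2 ≤ k) with rfl | rfl | hk2
    · refine Or.inl (Or.inl ?_)
      have h1 : ∀ᶠ t in atTop, |(φ v t).1| < Real.pi :=
        ((continuous_fst.tendsto _).comp hk).abs.eventually_lt_const (by simpa using hπ)
      have h2 : ∀ᶠ t in atTop, energy a (φ v t) < 2 * a :=
        (((continuous_energy a).tendsto _).comp hk).eventually_lt_const (by simpa [energy] using ha)
      obtain ⟨T, ⟨h1, h2⟩, h3⟩ := ((h1.and h2).and (eventually_ge_atTop 0)).exists
      exact ⟨T, h3, h1, h2⟩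
    · exact Or.inr ((hφ v).isSep ha hb hv0 (by rw [hφ0]; exact hθ0) (by rw [hφ0]; exact hθπ) hk)
    · exact Or.inl (Or.inr ((hφ v).exists_crossing ha hb hv0 hk2 hk))
  have h0B : (0 : ℝ) ∈ B := by
    refine ⟨0, le_rfl, ?_, ?_⟩
    · rw [hφ0, abs_of_nonneg hθ0]
      exact hθπ
    · have : Real.cos Real.pi < Real.cos θ₀ := Real.cos_lt_cos_of_nonneg_of_le_pi hθ0 le_rfl hθπ
      rw [Real.cos_pi] at this
      rw [hφ0]
      simp only [energy]
      nlinarith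
  have hsmall : ∀ r, 0 < r → (Ioo 0 r ∩ B).Nonempty := by
    intro r hr
    have h1 : B ∈ 𝓝[>] (0 : ℝ) := mem_nhdsWithin_of_mem_nhds (hBo.mem_nhds h0B)
    obtain ⟨v, hv⟩ := Filter.nonempty_of_mem (inter_mem (Ioo_mem_nhdsGT hr) h1)
    exact ⟨v, hv⟩
  have hlarge : ∀ r, (Ioi r ∩ A).Nonempty := by
    intro r
    refine ⟨max (r + 1) (a + b + 4), (lt_add_one r).trans_le (le_max_left _ _), 1,
      zero_le_one, ?_⟩
    apply (hφ _).crossing_of_large ha hb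
    · rw [hφ0]; exact hθ0
    · rw [hφ0]; exact le_max_right _ _
  have hex : ∃ V, 0 < V ∧ IsSep a b (φ V) := by
    by_contra! hc
    have hsub : Ioi (0 : ℝ) ⊆ B ∪ A := fun v hv => (htri v hv).resolve_right (hc v hv)
    have hne : (Ioi (0 : ℝ) ∩ B).Nonempty :=
      (hsmall 1 one_pos).mono (inter_subset_inter_left _ Ioo_subset_Ioi_self)
    have := isPreconnected_Ioi.subset_left_of_subset_union hBo hAo hdisj hsub hne
    obtain ⟨v, hv, hvA⟩ := hlarge 0
    exact Set.disjoint_left.1 hdisj (this hv) hvA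
  obtain ⟨V, hV, hsep⟩ := hex
  -- Uniqueness of the branch leaves only `V` uncovered, so each of the connected sets `(0, V)` and
  -- `(V, ∞)` lies in a single one of `B`, `A`.
  have hcov : ∀ v, 0 < v → v ≠ V → v ∈ B ∪ A := by
    intro v hv hne
    refine (htri v hv).resolve_right fun h => hne ?_
    have := h.snd_eq ha hb hsep (by simp [hφ0])
    simpa [hφ0] using this
  have hlow : Ioo 0 V ⊆ B :=
    isPreconnected_Ioo.subset_left_of_subset_union hBo hAo hdisj
      (fun v hv => hcov v hv.1 hv.2.ne) (hsmall V hV)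
  have hhigh : Ioi V ⊆ A :=
    isPreconnected_Ioi.subset_left_of_subset_union hAo hBo hdisj.symm
      (fun v hv => (hcov v (hV.trans hv) (ne_of_gt hv)).symm) (hlarge V)
  have heq : ∀ u, IsPend a b u → (u 0).1 = θ₀ → u = φ (u 0).2 := fun u hu h =>
    hu.eq_of_eq ha hb (hφ _) (t₀ := 0) (by rw [hφ0, ← h])
  refine ⟨V, hV, ⟨φ V, hsep, hφ0 V⟩, ?_, ?_⟩
  · intro u hu h h1 h2
    rw [heq u hu h]
    simpa using hBlim _ (hlow ⟨h1, h2⟩)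
  · intro u hu h h1
    rw [heq u hu h]
    exact hAlim _ (hhigh h1)

end

/-! ### Steps from the bottom of a well, by oddness and `2π`-periodicity -/

section

variable {a b : ℝ}

/-- The outcome of a frequency step of height `d` from the bottom of the well `k`, where `V` is the
critical height over `θ = 0`. -/
theorem exists_critical_step (ha : 0 < a) (hb : 0 < b) :
    ∃ V, 0 < V ∧ (∃ u, IsSep a b u ∧ u 0 = (0, V)) ∧
      ∀ u, IsPend a b u → ∀ (k : ℤ) (d : ℝ), u 0 = (((2 * k : ℤ) : ℝ) * Real.pi, d) →
        (|d| < V → Tendsto u atTop (𝓝 (((2 * k : ℤ) : ℝ) * Real.pi, 0))) ∧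
        (|d| = V → ∃ m : ℤ, |2 * k - m| = 1 ∧ Tendsto u atTop (𝓝 ((m : ℝ) * Real.pi, 0))) ∧
        (V < |d| → ∃ m : ℤ, 2 ≤ |2 * k - m| ∧
          Tendsto u atTop (𝓝 ((m : ℝ) * Real.pi, 0))) := by
  obtain ⟨V, hV, ⟨s, hs, hs0⟩, hlow, hhigh⟩ :=
    exists_critical_height ha hb le_rfl Real.pi_pos
  have hup : ∀ u, IsPend a b u → ∀ d : ℝ, 0 ≤ d → u 0 = (0, d) →
      (d < V → Tendsto u atTop (𝓝 (((0 : ℤ) : ℝ) * Real.pi, 0))) ∧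
      (d = V → ∃ m : ℤ, m = 1 ∧ Tendsto u atTop (𝓝 ((m : ℝ) * Real.pi, 0))) ∧
      (V < d → ∃ m : ℤ, 2 ≤ m ∧ Tendsto u atTop (𝓝 ((m : ℝ) * Real.pi, 0))) := by
    intro u hu d hd hu0
    refine ⟨fun h => ?_, fun h => ⟨1, rfl, ?_⟩, fun h => ?_⟩
    -- The critical-height dichotomy requires `v > 0`; height `0` is the equilibrium itself.
    · rcases hd.eq_or_lt with h0 | h0
      · have : u = fun _ => (0, 0) :=
          hu.eq_of_eq ha hb (isPend_const (by simp) rfl) (t₀ := 0) (by rw [hu0, ← h0])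
        rw [this]
        simp
      · simpa using hlow u hu (by rw [hu0]) (by rw [hu0]; exact h0) (by rw [hu0]; exact h)
    · rw [hu.eq_of_eq ha hb hs.isPend (t₀ := 0) (by rw [hu0, hs0, h])]
      simpa using hs.tendsto
    · exact hhigh u hu (by rw [hu0]) (by rw [hu0]; exact h)
  have hzero : ∀ u, IsPend a b u → ∀ d : ℝ, u 0 = (0, d) →
      (|d| < V → Tendsto u atTop (𝓝 (((0 : ℤ) : ℝ) * Real.pi, 0))) ∧
      (|d| = V → ∃ m : ℤ, |m| = 1 ∧ Tendsto u atTop (𝓝 ((m : ℝ) * Real.pi, 0))) ∧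
      (V < |d| → ∃ m : ℤ, 2 ≤ |m| ∧ Tendsto u atTop (𝓝 ((m : ℝ) * Real.pi, 0))) := by
    intro u hu d hu0
    rcases le_total 0 d with hd | hd
    · rw [abs_of_nonneg hd]
      obtain ⟨h1, h2, h3⟩ := hup u hu d hd hu0
      refine ⟨h1, fun h => ?_, fun h => ?_⟩
      · obtain ⟨m, rfl, hm⟩ := h2 h
        exact ⟨1, abs_one, hm⟩
      · obtain ⟨m, hm2, hm⟩ := h3 h
        exact ⟨m, hm2.trans (le_abs_self m), hm⟩
    · rw [abs_of_nonpos hd]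
      have hneg : ∀ m : ℤ, Tendsto (fun t => -u t) atTop (𝓝 ((m : ℝ) * Real.pi, 0)) →
          Tendsto u atTop (𝓝 (((-m : ℤ) : ℝ) * Real.pi, 0)) := fun m hm => by
        simpa using hm.neg
      obtain ⟨h1, h2, h3⟩ := hup _ hu.neg (-d) (by linarith) (by simp [hu0])
      refine ⟨fun h => hneg 0 (h1 h), fun h => ?_, fun h => ?_⟩
      · obtain ⟨m, rfl, hm⟩ := h2 h
        exact ⟨-1, by simp, hneg 1 hm⟩
      · obtain ⟨m, hm2, hm⟩ := h3 h
        exact ⟨-m, by rw [abs_neg]; exact hm2.trans (le_abs_self m), hneg m hm⟩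
  refine ⟨V, hV, ⟨s, hs, hs0⟩, fun u hu k d hu0 => ?_⟩
  have hback : ∀ m : ℤ, Tendsto (fun t => u t + (((-k : ℤ) : ℝ) * (2 * Real.pi), 0)) atTop
      (𝓝 ((m : ℝ) * Real.pi, 0)) →
      Tendsto u atTop (𝓝 (((2 * k + m : ℤ) : ℝ) * Real.pi, 0)) := by
    intro m hm
    have := hm.sub_const (((-k : ℤ) : ℝ) * (2 * Real.pi), (0 : ℝ))
    simp only [add_sub_cancel_right] at this
    convert this using 2
    ext
    · push_cast
      simp only [Prod.fst_sub]
      ring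
    · simp
  obtain ⟨h1, h2, h3⟩ := hzero _ (hu.add_two_pi (-k)) d (by
    rw [hu0]
    ext
    · push_cast
      simp only [Prod.fst_add]
      ring
    · simp)
  refine ⟨fun h => by simpa using hback 0 (h1 h), fun h => ?_, fun h => ?_⟩
  · obtain ⟨m, hm1, hm⟩ := h2 h
    exact ⟨2 * k + m, by rw [← hm1, ← abs_neg]; ring_nf, hback m hm⟩
  · obtain ⟨m, hm1, hm⟩ := h3 h
    exact ⟨2 * k + m, by rw [← abs_neg]; ring_nf; exact hm1, hback m hm⟩

end

/-! ### Back to the loop: locked states, separatrix, pull-out -/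

/-- The coordinates `(θ, ω - (K₀/τ₁) x)`. -/
noncomputable def pendCoord (K₀ τ₁ ω : ℝ) (p : ℝ × ℝ) : ℝ × ℝ := (p.1, ω - K₀ / τ₁ * p.2)

section

variable {K₀ τ₁ τ₂ ω : ℝ} {z : ℝ → ℝ × ℝ}

theorem pendCoord_xeq (hK₀ : 0 < K₀) (hτ₁ : 0 < τ₁) (ω θ : ℝ) :
    pendCoord K₀ τ₁ ω (θ, xeq K₀ τ₁ ω) = (θ, 0) := by
  unfold pendCoord xeq
  ext
  · rfl
  · simp only
    field_simp
    ring

theorem continuous_pendCoord (K₀ τ₁ ω : ℝ) : Continuous (pendCoord K₀ τ₁ ω) := by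
  unfold pendCoord
  fun_prop

theorem isTrajectory_iff (hK₀ : 0 < K₀) (hτ₁ : 0 < τ₁) :
    IsTrajectory K₀ τ₁ τ₂ ω z ↔
      IsPend (K₀ / τ₁) (K₀ / τ₁ * τ₂) fun t => pendCoord K₀ τ₁ ω (z t) := by
  constructor
  · intro hz t
    have h1 : HasDerivAt (fun t => (z t).1) _ t :=
      (ContinuousLinearMap.fst ℝ ℝ ℝ).hasFDerivAt.comp_hasDerivAt t (hz t)
    have h2 : HasDerivAt (fun t => (z t).2) _ t :=
      (ContinuousLinearMap.snd ℝ ℝ ℝ).hasFDerivAt.comp_hasDerivAt t (hz t)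
    refine (h1.prodMk ((h2.const_mul (K₀ / τ₁)).const_sub ω)).congr_deriv ?_
    ext
    · simp [field, pendField, pendCoord]
      ring
    · simp [field, pendField, pendCoord]
  · intro hu t
    have h1 := hu.hasDerivAt_fst t
    have h2 := ((hu.hasDerivAt_snd t).const_sub ω).const_mul (K₀ / τ₁)⁻¹
    have h3 := h1.prodMk h2
    have hz : z = fun t => ((pendCoord K₀ τ₁ ω (z t)).1,
        (K₀ / τ₁)⁻¹ * (ω - (pendCoord K₀ τ₁ ω (z t)).2)) := by
      funext s
      ext
      · rfl
      · simp only [pendCoord]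
        field_simp
        ring
    rw [← hz] at h3
    refine h3.congr_deriv ?_
    ext
    · simp [field, pendCoord]
      ring
    · simp only [field, pendCoord]
      field_simp

theorem tendsto_iff_pendCoord (hK₀ : 0 < K₀) (hτ₁ : 0 < τ₁) {θ : ℝ} :
    Tendsto z atTop (𝓝 (θ, xeq K₀ τ₁ ω)) ↔
      Tendsto (fun t => pendCoord K₀ τ₁ ω (z t)) atTop (𝓝 (θ, 0)) := by
  constructor
  · intro h
    rw [← pendCoord_xeq hK₀ hτ₁ ω θ]
    exact ((continuous_pendCoord K₀ τ₁ ω).tendsto _).comp h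
  · intro h
    have h1 : Tendsto (fun t => (z t).1) atTop (𝓝 θ) := (continuous_fst.tendsto _).comp h
    have h2 : Tendsto (fun t => ω - K₀ / τ₁ * (z t).2) atTop (𝓝 0) :=
      (continuous_snd.tendsto _).comp h
    refine h1.prodMk_nhds (((h2.const_sub ω).const_mul (K₀ / τ₁)⁻¹).congr' ?_ |>.trans_eq ?_)
    · filter_upwards with t
      field_simp
      ring
    · unfold xeq
      congr 1
      field_simp
      ring

theorem exists_isTrajectory (hK₀ : 0 < K₀) (hτ₁ : 0 < τ₁) (hτ₂ : 0 < τ₂) (ω : ℝ) (p : ℝ × ℝ) :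
    ∃ z, IsTrajectory K₀ τ₁ τ₂ ω z ∧ z 0 = p := by
  obtain ⟨u, hu0, hu⟩ := exists_isPend (show 0 < K₀ / τ₁ by positivity)
    (show 0 < K₀ / τ₁ * τ₂ by positivity) (pendCoord K₀ τ₁ ω p)
  have hz : ∀ q, pendCoord K₀ τ₁ ω (q.1, (K₀ / τ₁)⁻¹ * (ω - q.2)) = q := by
    intro q
    ext
    · rfl
    · simp only [pendCoord]
      field_simp
      ring
  refine ⟨fun t => ((u t).1, (K₀ / τ₁)⁻¹ * (ω - (u t).2)), ?_, ?_⟩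
  · rw [isTrajectory_iff hK₀ hτ₁]
    simpa only [hz] using hu
  · simp only [hu0, pendCoord]
    ext
    · rfl
    · simp only
      field_simp
      ring

theorem isEquilibrium_iff (hK₀ : 0 < K₀) (hτ₁ : 0 < τ₁) {p : ℝ × ℝ} :
    IsEquilibrium K₀ τ₁ τ₂ ω p ↔ ∃ k : ℤ, p = ((k : ℝ) * Real.pi, xeq K₀ τ₁ ω) := by
  obtain ⟨θ, x⟩ := p
  simp only [IsEquilibrium, field, Prod.mk_eq_zero, Prod.mk.injEq, xeq]
  constructor
  · rintro ⟨h1, h2⟩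
    obtain ⟨k, hk⟩ := Real.sin_eq_zero_iff.1 h2
    refine ⟨k, hk.symm, ?_⟩
    rw [h2] at h1
    field_simp at h1 ⊢
    linarith
  · rintro ⟨k, rfl, rfl⟩
    rw [Real.sin_int_mul_pi]
    refine ⟨?_, rfl⟩
    field_simp
    ring

theorem IsTrajectory.exists_tendsto (hK₀ : 0 < K₀) (hτ₁ : 0 < τ₁) (hτ₂ : 0 < τ₂)
    (hz : IsTrajectory K₀ τ₁ τ₂ ω z) :
    ∃ k : ℤ, Tendsto z atTop (𝓝 ((k : ℝ) * Real.pi, xeq K₀ τ₁ ω)) := by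
  obtain ⟨k, hk⟩ := ((isTrajectory_iff hK₀ hτ₁).1 hz).exists_tendsto (by positivity)
    (by positivity)
  exact ⟨k, (tendsto_iff_pendCoord hK₀ hτ₁).2 hk⟩

theorem isGloballyAsymptoticallyStable (hK₀ : 0 < K₀) (hτ₁ : 0 < τ₁) (hτ₂ : 0 < τ₂) (ω : ℝ) :
    IsGloballyAsymptoticallyStable K₀ τ₁ τ₂ ω := fun _ hz => by
  obtain ⟨k, hk⟩ := hz.exists_tendsto hK₀ hτ₁ hτ₂
  exact ⟨_, (isEquilibrium_iff hK₀ hτ₁).2 ⟨k, rfl⟩, hk⟩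

/-- For a convergent trajectory the limsup is a limit, so slipping depends only on the distance
between initial and final phase. -/
theorem cycleSlips_iff {q : ℝ × ℝ} (h : Tendsto z atTop (𝓝 q)) :
    CycleSlips z ↔ 2 * Real.pi ≤ |(z 0).1 - q.1| := by
  have h1 : Tendsto (fun t => ((|(z 0).1 - (z t).1| : ℝ) : EReal)) atTop
      (𝓝 ((|(z 0).1 - q.1| : ℝ) : EReal)) :=
    (continuous_coe_real_ereal.tendsto _).comp
      (((continuous_fst.tendsto _).comp h).const_sub _).abs
  rw [CycleSlips, h1.limsup_eq, EReal.coe_le_coe_iff]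

/-- The locked states are the equilibria at even multiples of `π`. -/
theorem isLockedState_iff (hK₀ : 0 < K₀) (hτ₁ : 0 < τ₁) (hτ₂ : 0 < τ₂) {p : ℝ × ℝ} :
    IsLockedState K₀ τ₁ τ₂ ω p ↔
      ∃ k : ℤ, p = (((2 * k : ℤ) : ℝ) * Real.pi, xeq K₀ τ₁ ω) := by
  have hπ := Real.pi_pos
  have ha : 0 < K₀ / τ₁ := by positivity
  have hb : 0 < K₀ / τ₁ * τ₂ := by positivity
  constructor
  · rintro ⟨heq, hstab, -⟩
    obtain ⟨n, rfl⟩ := (isEquilibrium_iff hK₀ hτ₁).1 heq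
    rcases Int.even_or_odd' n with ⟨j, rfl | rfl⟩
    · exact ⟨j, rfl⟩
    exfalso
    obtain ⟨δ, hδ, h⟩ := hstab 1 one_pos
    -- Lowering `x` at a saddle makes `v > 0`; after a shift to the saddle at `π` the limit lies at
    -- least `π > 1` away, which contradicts stability for `ε = 1`.
    obtain ⟨z, hz, hz0⟩ := exists_isTrajectory hK₀ hτ₁ hτ₂ ω
      (((2 * j + 1 : ℤ) : ℝ) * Real.pi, xeq K₀ τ₁ ω - δ / 2)
    have hnear := h z hz (by
      rw [hz0, Prod.dist_eq, dist_self, Real.dist_eq]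
      rw [show xeq K₀ τ₁ ω - δ / 2 - xeq K₀ τ₁ ω = -(δ / 2) by ring, abs_neg,
        abs_of_pos (by positivity)]
      simp [hδ])
    obtain ⟨k, hk⟩ := hz.exists_tendsto hK₀ hτ₁ hτ₂
    have hu := ((isTrajectory_iff hK₀ hτ₁).1 hz).add_two_pi (-j)
    have hlim : Tendsto (fun t => pendCoord K₀ τ₁ ω (z t) + (((-j : ℤ) : ℝ) * (2 * Real.pi), 0))
        atTop (𝓝 (((k - 2 * j : ℤ) : ℝ) * Real.pi, 0)) := by
      convert ((tendsto_iff_pendCoord hK₀ hτ₁).1 hk).add_const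
        (((-j : ℤ) : ℝ) * (2 * Real.pi), (0 : ℝ)) using 2
      ext
      · push_cast
        simp only [Prod.fst_add]
        ring
      · simp
    have hk2 := hu.two_le_of_tendsto ha hb (by
      have h1 := congrArg Prod.snd (pendCoord_xeq hK₀ hτ₁ ω 0)
      simp only [pendCoord] at h1
      simp only [hz0, pendCoord, Prod.snd_add]
      nlinarith [mul_pos ha hδ]) (by
      simp only [hz0, pendCoord, Prod.fst_add]
      push_cast
      linarith) hlim
    have h1 : Tendsto (fun t => dist (z t) (((2 * j + 1 : ℤ) : ℝ) * Real.pi, xeq K₀ τ₁ ω)) atTop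
        (𝓝 (dist ((k : ℝ) * Real.pi, xeq K₀ τ₁ ω)
          (((2 * j + 1 : ℤ) : ℝ) * Real.pi, xeq K₀ τ₁ ω))) :=
      hk.dist tendsto_const_nhds
    have h2 : dist ((k : ℝ) * Real.pi, xeq K₀ τ₁ ω)
        (((2 * j + 1 : ℤ) : ℝ) * Real.pi, xeq K₀ τ₁ ω) ≤ 1 := by
      refine le_of_tendsto h1 ?_
      filter_upwards [eventually_ge_atTop 0] with t ht using (hnear t ht).le
    rw [Prod.dist_eq, dist_self, max_eq_left dist_nonneg, Real.dist_eq, ← sub_mul, abs_mul,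
      abs_of_pos hπ] at h2
    have h3 : (1 : ℝ) ≤ (k : ℝ) - ((2 * j + 1 : ℤ) : ℝ) := by
      have : (1 : ℤ) ≤ k - (2 * j + 1) := by omega
      exact_mod_cast this
    have h4 := le_abs_self ((k : ℝ) - ((2 * j + 1 : ℤ) : ℝ))
    nlinarith [Real.pi_gt_three]
  · rintro ⟨k, rfl⟩
    set p : ℝ × ℝ := (((2 * k : ℤ) : ℝ) * Real.pi, xeq K₀ τ₁ ω) with hp
    have hcp := pendCoord_xeq hK₀ hτ₁ ω (((2 * k : ℤ) : ℝ) * Real.pi)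
    have hcos : ∀ x : ℝ, Real.cos (x - ((2 * k : ℤ) : ℝ) * Real.pi) = Real.cos x := by
      intro x
      rw [← Real.cos_sub_int_mul_two_pi x k]
      congr 1
      push_cast
      ring
    have hE0 : energy (K₀ / τ₁) (pendCoord K₀ τ₁ ω p) = 0 := by
      rw [hp, hcp, energy, ← hcos, sub_self]
      simp
    have hEnear : ∀ c > 0, ∃ δ > 0, ∀ q, dist q p < δ →
        energy (K₀ / τ₁) (pendCoord K₀ τ₁ ω q) < c := by
      intro c hc
      have h1 : ∀ᶠ q in 𝓝 p, energy (K₀ / τ₁) (pendCoord K₀ τ₁ ω q) < c :=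
        (((continuous_energy _).comp (continuous_pendCoord K₀ τ₁ ω)).tendsto p).eventually_lt_const
          (by simpa [hE0] using hc)
      exact Metric.eventually_nhds_iff.1 h1
    have hfst : ∀ q, dist q p = max |q.1 - ((2 * k : ℤ) : ℝ) * Real.pi| |q.2 - xeq K₀ τ₁ ω| :=
      fun q => by rw [Prod.dist_eq, Real.dist_eq, Real.dist_eq]
    refine ⟨(isEquilibrium_iff hK₀ hτ₁).2 ⟨2 * k, rfl⟩, ?_, ?_⟩
    · intro ε hε
      set r : ℝ := min ε (Real.pi / 2) with hr
      have hr0 : 0 < r := lt_min hε (by positivity)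
      have hrπ : r ≤ Real.pi / 2 := min_le_right _ _
      have hcr : Real.cos r < 1 := by
        rw [← Real.cos_zero]
        exact Real.cos_lt_cos_of_nonneg_of_le_pi le_rfl (by linarith) hr0
      -- The first level keeps the phase from reaching distance `r`; the second bounds `|v|` by `(K₀
      -- / τ₁) ε`, that is, `x` to within `ε`.
      set c : ℝ := min (K₀ / τ₁ * (1 - Real.cos r)) ((K₀ / τ₁ * ε) ^ 2 / 2) with hc
      have hc0 : 0 < c := lt_min (mul_pos ha (by linarith)) (by positivity)
      obtain ⟨δ, hδ, hE⟩ := hEnear c hc0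
      refine ⟨min δ r, lt_min hδ hr0, fun z hz hz0 t ht => ?_⟩
      have hu := (isTrajectory_iff hK₀ hτ₁).1 hz
      have hEt : ∀ s, 0 ≤ s → energy (K₀ / τ₁) (pendCoord K₀ τ₁ ω (z s)) < c := fun s hs =>
        (hu.antitone_energy ha hb hs).trans_lt (hE _ (hz0.trans_le (min_le_left _ _)))
      have hz0' : |(z 0).1 - ((2 * k : ℤ) : ℝ) * Real.pi| < r :=
        ((le_max_left _ _).trans_eq (hfst (z 0)).symm).trans_lt (hz0.trans_le (min_le_right _ _))
      have hzt : |(z t).1 - ((2 * k : ℤ) : ℝ) * Real.pi| < r := by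
        by_contra! hcon
        have hcz : Continuous z := continuous_iff_continuousAt.2 fun t => (hz t).continuousAt
        have hcont : ContinuousOn (fun t => |(z t).1 - ((2 * k : ℤ) : ℝ) * Real.pi|)
            (Icc 0 t) := by
          fun_prop
        obtain ⟨s, hs, hs'⟩ := intermediate_value_Icc ht hcont ⟨hz0'.le, hcon⟩
        have h1 := (hEt s hs.1).trans_le (min_le_left _ _)
        simp only at hs'
        simp only [energy, pendCoord] at h1
        rw [← hcos, ← Real.cos_abs, hs'] at h1
        nlinarith [sq_nonneg (ω - K₀ / τ₁ * (z s).2)]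
      rw [hfst]
      refine max_lt (hzt.trans_le (min_le_left _ _)) ?_
      have h1 := (hEt t ht).trans_le (min_le_right _ _)
      have h2 : ω - K₀ / τ₁ * (z t).2 = -(K₀ / τ₁ * ((z t).2 - xeq K₀ τ₁ ω)) := by
        have h1 := congrArg Prod.snd hcp
        simp only [pendCoord] at h1
        linarith
      simp only [energy, pendCoord, h2] at h1
      have h3 : 0 ≤ K₀ / τ₁ * (1 - Real.cos (z t).1) :=
        mul_nonneg ha.le (by linarith [Real.cos_le_one (z t).1])
      have h4 : (K₀ / τ₁ * ((z t).2 - xeq K₀ τ₁ ω)) ^ 2 < (K₀ / τ₁ * ε) ^ 2 := by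
        rw [neg_sq] at h1
        linarith
      have h5 := abs_lt_of_sq_lt_sq h4 (by positivity)
      rw [abs_mul, abs_of_pos ha] at h5
      exact lt_of_mul_lt_mul_left h5 ha.le
    · obtain ⟨δ, hδ, hE⟩ := hEnear (2 * (K₀ / τ₁)) (by positivity)
      refine ⟨min δ Real.pi, lt_min hδ hπ, fun z hz hz0 => ?_⟩
      have hu := (isTrajectory_iff hK₀ hτ₁).1 hz
      refine (tendsto_iff_pendCoord hK₀ hτ₁).2 (hu.trapped ha hb (t₁ := 0) ?_ ?_).2
      · exact hE _ (hz0.trans_le (min_le_left _ _))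
      · exact ((le_max_left _ _).trans_eq (hfst (z 0)).symm).trans_lt
          (hz0.trans_le (min_le_right _ _))

/-- Over `θ ∈ [0, π)`, where the upper branch of the pendulum has height `V`, the lower separatrix
consists of one point. -/
theorem mem_lowerSeparatrix_iff (hK₀ : 0 < K₀) (hτ₁ : 0 < τ₁) (hτ₂ : 0 < τ₂) {θ V : ℝ}
    {u : ℝ → ℝ × ℝ} (hu : IsSep (K₀ / τ₁) (K₀ / τ₁ * τ₂) u) (hu0 : u 0 = (θ, V)) (ω x : ℝ) :
    (θ, x) ∈ lowerSeparatrix K₀ τ₁ τ₂ ω ↔ x = (ω - V) / (K₀ / τ₁) := by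
  have ha : 0 < K₀ / τ₁ := by positivity
  have hb : 0 < K₀ / τ₁ * τ₂ := by positivity
  have hxeq : K₀ / τ₁ * xeq K₀ τ₁ ω = ω := by
    unfold xeq
    field_simp
  constructor
  · rintro ⟨z, hz, hz0, hlt, hlim⟩
    have hw : IsSep (K₀ / τ₁) (K₀ / τ₁ * τ₂) fun t => pendCoord K₀ τ₁ ω (z t) := by
      refine ⟨(isTrajectory_iff hK₀ hτ₁).1 hz, ?_, ?_, fun t ht => ?_,
        (tendsto_iff_pendCoord hK₀ hτ₁).1 hlim⟩
      · simpa [hz0, hu0, pendCoord] using hu.nonneg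
      · simpa [hz0, hu0, pendCoord] using hu.lt_pi
      · simp only [pendCoord]
        nlinarith [mul_lt_mul_of_pos_left (hlt t ht) ha]
    have h := hu.snd_eq ha hb hw (by simp [hz0, hu0, pendCoord])
    rw [hu0, hz0] at h
    simp only [pendCoord] at h
    rw [eq_div_iff ha.ne']
    linarith
  · rintro rfl
    obtain ⟨z, hz, hz0⟩ := exists_isTrajectory hK₀ hτ₁ hτ₂ ω (θ, (ω - V) / (K₀ / τ₁))
    have heq : (fun t => pendCoord K₀ τ₁ ω (z t)) = u := by
      refine ((isTrajectory_iff hK₀ hτ₁).1 hz).eq_of_eq ha hb hu.isPend (t₀ := 0) ?_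
      rw [hz0, hu0]
      simp only [pendCoord]
      rw [mul_div_cancel₀ _ ha.ne', sub_sub_cancel]
    refine ⟨z, hz, hz0, fun t ht => ?_, ?_⟩
    · have h1 := hu.pos t ht
      rw [← heq] at h1
      simp only [pendCoord] at h1
      exact lt_of_mul_lt_mul_left (by linarith) ha.le
    · rw [tendsto_iff_pendCoord hK₀ hτ₁, heq]
      exact hu.tendsto

/-- The choice by `epsilon` is determined, since the separatrix has exactly one point over `θ`. -/
theorem Q_eq (hK₀ : 0 < K₀) (hτ₁ : 0 < τ₁) (hτ₂ : 0 < τ₂) {θ V : ℝ}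
    {u : ℝ → ℝ × ℝ} (hu : IsSep (K₀ / τ₁) (K₀ / τ₁ * τ₂) u) (hu0 : u 0 = (θ, V)) (ω : ℝ) :
    Q K₀ τ₁ τ₂ θ ω = (ω - V) / (K₀ / τ₁) := by
  have h := mem_lowerSeparatrix_iff hK₀ hτ₁ hτ₂ hu hu0 ω
  exact (h _).1 (Classical.epsilon_spec (p := fun x => (θ, x) ∈ lowerSeparatrix K₀ τ₁ τ₂ ω)
    ⟨_, (h _).2 rfl⟩)

/-- The outcome of a frequency step `Δ` from a locked state. -/
theorem exists_pull_out (hK₀ : 0 < K₀) (hτ₁ : 0 < τ₁) (hτ₂ : 0 < τ₂) :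
    ∃ V, 0 < V ∧ (∃ u, IsSep (K₀ / τ₁) (K₀ / τ₁ * τ₂) u ∧ u 0 = (0, V)) ∧
      ∀ ω Δ p, IsLockedState K₀ τ₁ τ₂ ω p → ∀ z, IsTrajectory K₀ τ₁ τ₂ (ω + Δ) z → z 0 = p →
        (|Δ| < V → (∃ q, IsLockedState K₀ τ₁ τ₂ (ω + Δ) q ∧ Tendsto z atTop (𝓝 q)) ∧
          ¬ CycleSlips z) ∧
        (|Δ| = V → (¬ ∃ q, IsLockedState K₀ τ₁ τ₂ (ω + Δ) q ∧ Tendsto z atTop (𝓝 q)) ∧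
          ¬ CycleSlips z) ∧
        (V < |Δ| → CycleSlips z) := by
  have hπ := Real.pi_pos
  obtain ⟨V, hV, hsep, hstep⟩ := exists_critical_step (show 0 < K₀ / τ₁ by positivity)
    (show 0 < K₀ / τ₁ * τ₂ by positivity)
  refine ⟨V, hV, hsep, ?_⟩
  intro ω Δ p hp z hz hz0
  obtain ⟨k, rfl⟩ := (isLockedState_iff hK₀ hτ₁ hτ₂).1 hp
  -- The state is continuous across the jump, so `v` jumps from `0` to `Δ`.
  have hu0 : pendCoord K₀ τ₁ (ω + Δ) (z 0) = (((2 * k : ℤ) : ℝ) * Real.pi, Δ) := by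
    rw [hz0]
    ext
    · rfl
    · simp only [pendCoord, xeq]
      field_simp
      ring
  have hdist : ∀ m : ℤ, |(z 0).1 - (m : ℝ) * Real.pi| = ((|2 * k - m| : ℤ) : ℝ) * Real.pi := by
    intro m
    rw [hz0, ← sub_mul, abs_mul, abs_of_pos hπ]
    push_cast
    rfl
  obtain ⟨h1, h2, h3⟩ := hstep _ ((isTrajectory_iff hK₀ hτ₁).1 hz) k Δ hu0
  refine ⟨fun h => ?_, fun h => ?_, fun h => ?_⟩
  · have hlim := (tendsto_iff_pendCoord hK₀ hτ₁).2 (h1 h)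
    refine ⟨⟨_, (isLockedState_iff hK₀ hτ₁ hτ₂).2 ⟨k, rfl⟩, hlim⟩, ?_⟩
    rw [cycleSlips_iff hlim, hdist, sub_self]
    simp [hπ]
  · obtain ⟨m, hm1, hm⟩ := h2 h
    have hlim := (tendsto_iff_pendCoord hK₀ hτ₁).2 hm
    constructor
    · rintro ⟨q, hq, hlim'⟩
      obtain ⟨j, rfl⟩ := (isLockedState_iff hK₀ hτ₁ hτ₂).1 hq
      have := int_eq_of_tendsto hm ((tendsto_iff_pendCoord hK₀ hτ₁).1 hlim')
      rcases (abs_eq zero_le_one).1 hm1 with h | h <;> omega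
    · rw [cycleSlips_iff hlim, hdist, hm1]
      push_cast
      linarith
  · obtain ⟨m, hm2, hm⟩ := h3 h
    rw [cycleSlips_iff ((tendsto_iff_pendCoord hK₀ hτ₁).2 hm), hdist]
    have : (2 : ℝ) ≤ ((|2 * k - m| : ℤ) : ℝ) := by exact_mod_cast hm2
    nlinarith

end

end PLL

/-! ### Assembly: pull-out frequency `V`, lock-in frequency `V / 2` -/

theorem mainTheorem4 (K₀ τ₁ τ₂ : ℝ) (hK₀ : 0 < K₀) (hτ₁ : 0 < τ₁) (hτ₂ : 0 < τ₂) :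
    -- over `[0, π)` the lower separatrix is the graph of `Q(·, ω)`
    (∀ ω θ : ℝ, 0 ≤ θ → θ < Real.pi → ∀ x : ℝ,
      (θ, x) ∈ PLL.lowerSeparatrix K₀ τ₁ τ₂ ω ↔ x = PLL.Q K₀ τ₁ τ₂ θ ω) ∧
    -- the lock-in frequency is the maximal bound of a lock-in range
    IsGreatest (PLL.lockInBounds K₀ τ₁ τ₂) (PLL.lockInFrequency K₀ τ₁ τ₂) ∧
    ∀ ω : ℝ,
      -- the pull-out frequency is the maximal step without cycle slip
      IsGreatest (PLL.slipFreeSteps K₀ τ₁ τ₂ ω) (PLL.pullOutFrequency K₀ τ₁ τ₂ ω) ∧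
      -- below it the loop locks again without cycle slipping
      (∀ Δ : ℝ, |Δ| < PLL.pullOutFrequency K₀ τ₁ τ₂ ω →
        ∀ p, PLL.IsLockedState K₀ τ₁ τ₂ ω p → p ∈ PLL.lockInDomain K₀ τ₁ τ₂ (ω + Δ)) ∧
      -- above it cycle slipping occurs
      (∀ Δ : ℝ, PLL.pullOutFrequency K₀ τ₁ τ₂ ω < |Δ| →
        ∀ p, PLL.IsLockedState K₀ τ₁ τ₂ ω p →
          ∀ z, PLL.IsTrajectory K₀ τ₁ τ₂ (ω + Δ) z → z 0 = p → PLL.CycleSlips z) ∧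
      PLL.xeq K₀ τ₁ ω = PLL.Q K₀ τ₁ τ₂ 0 (ω + PLL.pullOutFrequency K₀ τ₁ τ₂ ω) ∧
      PLL.pullOutFrequency K₀ τ₁ τ₂ ω = -(K₀ * PLL.Q K₀ τ₁ τ₂ 0 0) / τ₁ ∧
      PLL.pullOutFrequency K₀ τ₁ τ₂ ω = 2 * PLL.lockInFrequency K₀ τ₁ τ₂ := by
  have ha : 0 < K₀ / τ₁ := by positivity
  have hb : 0 < K₀ / τ₁ * τ₂ := by positivity
  obtain ⟨V, hV, ⟨u, hu, hu0⟩, hpull⟩ := PLL.exists_pull_out hK₀ hτ₁ hτ₂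
  have hlocked : ∀ ω, PLL.IsLockedState K₀ τ₁ τ₂ ω (0, PLL.xeq K₀ τ₁ ω) := fun ω =>
    (PLL.isLockedState_iff hK₀ hτ₁ hτ₂).2 ⟨0, by simp⟩
  have hdomain : ∀ ω Δ : ℝ, |Δ| < V → ∀ p, PLL.IsLockedState K₀ τ₁ τ₂ ω p →
      p ∈ PLL.lockInDomain K₀ τ₁ τ₂ (ω + Δ) := by
    intro ω Δ hΔ p hp
    obtain ⟨z, hz, hz0⟩ := PLL.exists_isTrajectory hK₀ hτ₁ hτ₂ (ω + Δ) p
    obtain ⟨hq, hslip⟩ := (hpull ω Δ p hp z hz hz0).1 hΔ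
    exact ⟨z, hz, hz0, hq, hslip⟩
  have hpo : ∀ ω, IsGreatest (PLL.slipFreeSteps K₀ τ₁ τ₂ ω) V := by
    intro ω
    constructor
    · exact ⟨hV.le, fun Δ hΔ p hp z hz hz0 => ((hpull ω Δ p hp z hz hz0).2.1 hΔ).2⟩
    · rintro s ⟨hs0, hs⟩
      by_contra! hc
      obtain ⟨z, hz, hz0⟩ := PLL.exists_isTrajectory hK₀ hτ₁ hτ₂ (ω + s) (0, PLL.xeq K₀ τ₁ ω)
      exact hs s (abs_of_nonneg hs0) _ (hlocked ω) z hz hz0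
        ((hpull ω s _ (hlocked ω) z hz hz0).2.2 (by rwa [abs_of_nonneg hs0]))
  have hpoV : ∀ ω, PLL.pullOutFrequency K₀ τ₁ τ₂ ω = V := fun ω => (hpo ω).csSup_eq
  have hl : IsGreatest (PLL.lockInBounds K₀ τ₁ τ₂) (V / 2) := by
    constructor
    · refine ⟨by positivity, fun ω hω =>
        ⟨PLL.isGloballyAsymptoticallyStable hK₀ hτ₁ hτ₂ ω, fun p hp => ?_⟩⟩
      simp only [mem_iInter, mem_ofPred_eq]
      intro ω' hω'
      have h1 : |ω' - ω| < V := by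
        have := abs_sub ω' ω
        linarith
      simpa using hdomain ω (ω' - ω) h1 p hp
    · rintro W ⟨hW0, hW⟩
      by_contra! hc
      -- The jump from `-V / 2` to `V / 2` has size exactly `V` and ends at a saddle, which is not a
      -- locked state.
      have h1 : |-(V / 2)| < W := by rwa [abs_neg, abs_of_pos (by positivity)]
      have h2 : |V / 2| < W := by rwa [abs_of_pos (by positivity)]
      have h3 := (hW _ h1).2 _ (hlocked _)
      simp only [mem_iInter, mem_ofPred_eq] at h3
      obtain ⟨z, hz, hz0, hq, -⟩ := h3 _ h2
      have h4 : V / 2 = -(V / 2) + V := by ring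
      rw [h4] at hz hq
      exact ((hpull _ V _ (hlocked _) z hz hz0).2.1 (abs_of_pos hV)).1 hq
  have hlV : PLL.lockInFrequency K₀ τ₁ τ₂ = V / 2 := hl.csSup_eq
  refine ⟨?_, by rwa [hlV], fun ω => ?_⟩
  · intro ω θ h0 hπ x
    obtain ⟨W, -, ⟨w, hw, hw0⟩, -⟩ := PLL.exists_critical_height ha hb h0 hπ
    rw [PLL.Q_eq hK₀ hτ₁ hτ₂ hw hw0]
    exact PLL.mem_lowerSeparatrix_iff hK₀ hτ₁ hτ₂ hw hw0 ω x
  · rw [hpoV, hlV, PLL.Q_eq hK₀ hτ₁ hτ₂ hu hu0, PLL.Q_eq hK₀ hτ₁ hτ₂ hu hu0]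
    refine ⟨hpo ω, hdomain ω, fun Δ hΔ p hp z hz hz0 => (hpull ω Δ p hp z hz hz0).2.2 hΔ,
      ?_, ?_, by ring⟩
    · unfold PLL.xeq
      rw [add_sub_cancel_right]
      field_simp
    · field_simp
      ring
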